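/- Let $\mathrm{Ai}(x)=\frac1\pi\int_0^\infty\cos\bigl(\tfrac{t^3}{3}+xt\bigr)\,dt$ (improper integral) be the Airy function of the first kind. For $c\in\mathbb R$ let $\mathcal T_c\colon L^2[0,\infty)\to L^2[0,\infty)$ (real-valued functions) be the operator $$\mathcal T_c[f](x)=\int_0^\infty \mathrm{Ai}(x+y+c)\,f(y)\,dy,\qquad x\ge 0 .$$ For every real $c$, the eigenvalues of $\mathcal T_c$ form an infinite sequence $\lambda_{0,c},\lambda_{1,c},\dots$, listed with multiplicity and ordered so that $|\lambda_{0,c}|\ge|\lambda_{1,c}|\ge\cdots$, with corresponding orthonormal eigenfunctions $\psi_{0,c},\psi_{1,c},\dots\in L^2[0,\infty)$, which satisfy $$\lambda_{n,c}\,\psi_{n,c}(x)=\int_0^\infty \mathrm{Ai}(x+y+c)\,\psi_{n,c}(y)\,dy\qquad\text{for all } x\ge 0$$ and which can be chosen with $\psi_{n,c}(0)>0$ for all $n$. For any such ordering and any such choice of orthonormal eigenfunctions at every $c$ (the sign of $\psi_{n,c}$ being irrelevant), for all real $c$ and all integers $n\ge 0$ the functions $c\mapsto\lambda_{n,c}$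 and $c\mapsto\lambda_{n,c}^2$ are differentiable at $c$ and $$\frac{\partial \lambda_{n,c}}{\partial c}=-\frac12\,\lambda_{n,c}\,\bigl(\psi_{n,c}(0)\bigr)^2,\qquad \frac{\partial (\lambda_{n,c}^2)}{\partial c}=-\lambda_{n,c}^2\,\bigl(\psi_{n,c}(0)\bigr)^2 .$$ -/

import Mathlib

open MeasureTheory Filter Topology

noncomputable section

/-- The Airy function of the first kind on the real line,
`Ai x = (1 / π) ∫_0^∞ cos (t ^ 3 / 3 + x t) dt`.  The integral converges only conditionally, so it
is the limit of the integrals over `[0, R]` as `R → ∞` (this limit exists for every real `x`). -/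
def airyAi (x : ℝ) : ℝ :=
  limUnder atTop fun R : ℝ =>
    (1 / Real.pi) * ∫ t in (0 : ℝ)..R, Real.cos (t ^ 3 / 3 + x * t)

/-- Lebesgue measure on the half-line `[0, ∞)`. -/
def halfLine : Measure ℝ := volume.restrict (Set.Ici 0)

/-- The Airy integral operator `T_c f (x) = ∫_0^∞ Ai (x + y + c) f y dy`. -/
def airyOp (c : ℝ) (f : ℝ → ℝ) (x : ℝ) : ℝ :=
  ∫ y, airyAi (x + y + c) * f y ∂halfLine

/-- `f ∈ L²[0, ∞)` is a nonzero solution of `μ f = T_c f` on `[0, ∞)`: an eigenfunction of `T_c`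
with eigenvalue `μ`. -/
structure IsAiryEigenpair (c μ : ℝ) (f : ℝ → ℝ) : Prop where
  memLp : MemLp f 2 halfLine
  ne_zero : ¬ f =ᵐ[halfLine] 0
  eigen : ∀ x : ℝ, 0 ≤ x → μ * f x = airyOp c f x

/-- `lam 0, lam 1, …` is the list of all eigenvalues of `T_c`, repeated according to multiplicity
and ordered by non-increasing absolute value, and `psi 0, psi 1, …` are corresponding eigenfunctions
that are orthonormal in `L²[0, ∞)`.  The values of `psi n` off `[0, ∞)` are irrelevant. -/
structure IsAiryEigensystem (c : ℝ) (lam : ℕ → ℝ) (psi : ℕ → ℝ → ℝ) : Prop where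
  eigenpair : ∀ n, IsAiryEigenpair c (lam n) (psi n)
  orthonormal : ∀ m n, ∫ x, psi m x * psi n x ∂halfLine = if m = n then 1 else 0
  /-- Nothing is missing from the list: no eigenfunction is orthogonal to all `psi n`. -/
  exhaustive : ∀ (μ : ℝ) (f : ℝ → ℝ), IsAiryEigenpair c μ f →
    ∃ n, ∫ x, psi n x * f x ∂halfLine ≠ 0
  ordered : ∀ n, |lam (n + 1)| ≤ |lam n|

end

open scoped RealInnerProductSpace

/-! The formula is Hellmann–Feynman. Since the kernel depends only on `x + y + c`, an eigenfunction
`F` of `T_c`, extended to the whole line by its eigenvalue equation, satisfies `T_t F (x) = μ F (x +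
t - c)`. Hence `⟪T_t F, F⟫ = μ ∫ F (y + t - c) F y` over the half-line, whose derivative at `t = c`
is `μ ∫ F' F = -μ (F 0)² / 2` when `F` decays.

To pass from this quadratic form to the ordered eigenvalues, the moduli `|λ_n|` must be strictly
decreasing. Everything rests on `IsAiryEigenfun.eq_zero`: an eigenfunction with `F 0 = 0` vanishes.
Integration by parts turns such an `F` into an eigenfunction `F'` for `-μ`, again vanishing at `0`,
so all derivatives of `F` are eigenfunctions. The Airy equation gives `‖F'‖² ≤ |c| ‖F‖²`, while a
weighted Poincaré inequality makes a weighted norm grow by at least `|c| + 1` at each step; both are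
possible only if `F = 0`. Then `F 0 • G - G 0 • F = 0` for two eigenfunctions with the same
eigenvalue, and `F 0 * G 0 = 0` for opposite ones, so the moduli are simple
(`hasSimpleModuli_airyL`).

Zero is not an eigenvalue (`ae_eq_zero_of_airyOp_eq_zero`), and `T_c` is compact, symmetric and
locally Lipschitz in `c`. The spectral theorem gives the eigensystems; Weyl's inequality for moduli
and a second-order remainder bound (`abs_eigenvalue_sub_sub_inner_le`) give the derivative.
Continuity of eigenvectors in `c` is never needed. -/

/-! ### Airy function on a shifted contour: decay and nonvanishing. -/

theorem I_mul_cubic_eq (x a s : ℝ) :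
    Complex.I * (((a : ℂ) + s * Complex.I) ^ 3 / 3 + x * (a + s * Complex.I)) =
      ((-(a ^ 2 * s) + (s ^ 3 / 3 - x * s) : ℝ) : ℂ) +
        ((a ^ 3 / 3 + (x - s ^ 2) * a : ℝ) : ℂ) * Complex.I := by
  push_cast
  ring_nf
  simp only [show Complex.I ^ 3 = -Complex.I from by rw [pow_succ, Complex.I_sq]; ring,
    show Complex.I ^ 4 = 1 from Complex.I_pow_four, Complex.I_sq]
  ring

theorem norm_exp_I_mul_cubic (x a s : ℝ) :
    ‖Complex.exp (Complex.I * (((a : ℂ) + s * Complex.I) ^ 3 / 3 + x * (a + s * Complex.I)))‖ =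
      Real.exp (-(a ^ 2 * s) + (s ^ 3 / 3 - x * s)) := by
  rw [Complex.norm_exp]
  congr 1
  rw [I_mul_cubic_eq]
  simp [-Complex.ofReal_add, -Complex.ofReal_mul, -Complex.ofReal_sub, -Complex.ofReal_neg]

theorem re_exp_I_mul_cubic (x a s : ℝ) :
    (Complex.exp (Complex.I * (((a : ℂ) + s * Complex.I) ^ 3 / 3 +
      x * (a + s * Complex.I)))).re =
      Real.exp (s ^ 3 / 3 - x * s) *
        (Real.exp (-s * a ^ 2) * Real.cos (a ^ 3 / 3 + (x - s ^ 2) * a)) := by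
  rw [I_mul_cubic_eq, Complex.exp_re, ← mul_assoc, ← Real.exp_add]
  simp [-Complex.ofReal_add, -Complex.ofReal_mul, -Complex.ofReal_sub, -Complex.ofReal_neg]
  left
  ring

theorem continuous_exp_I_mul_cubic (x : ℝ) :
    Continuous fun z : ℂ => Complex.exp (Complex.I * (z ^ 3 / 3 + x * z)) := by fun_prop

/-- On the vertical sides the integrand has modulus `exp (-R² s + s³/3 - x s)`, which tends to `0`
for every `s > 0` and is dominated by its value at `R = 0`. The hypothesis on `l` covers both sides
`±R`. -/
theorem tendsto_integral_cubic_side (x η : ℝ) (hη : 0 < η) {l : ℝ → ℝ}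
    (hl : ∀ R, l R ^ 2 = R ^ 2) :
    Tendsto (fun R : ℝ => ∫ s in (0 : ℝ)..η,
      Complex.exp (Complex.I * ((((l R : ℝ) : ℂ) + s * Complex.I) ^ 3 / 3 +
        x * ((l R : ℝ) + s * Complex.I)))) atTop (𝓝 0) := by
  have h0 : (0 : ℂ) = ∫ s in (0 : ℝ)..η, (0 : ℂ) := by simp
  rw [h0]
  refine intervalIntegral.tendsto_integral_filter_of_dominated_convergence
    (fun s => Real.exp (s ^ 3 / 3 - x * s)) ?_ ?_ ?_ ?_
  · refine Eventually.of_forall fun R => Continuous.aestronglyMeasurable ?_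
    fun_prop
  · refine Eventually.of_forall fun R => Eventually.of_forall fun s hs => ?_
    rw [norm_exp_I_mul_cubic, hl]
    rw [Set.uIoc_of_le hη.le] at hs
    have : 0 ≤ R ^ 2 * s := mul_nonneg (sq_nonneg R) hs.1.le
    gcongr
    linarith
  · exact Continuous.intervalIntegrable (by fun_prop) _ _
  · refine Eventually.of_forall fun s hs => ?_
    rw [Set.uIoc_of_le hη.le] at hs
    rw [tendsto_zero_iff_norm_tendsto_zero]
    simp_rw [norm_exp_I_mul_cubic, hl]
    refine Real.tendsto_exp_atBot.comp ?_
    refine tendsto_atBot_add_const_right _ _ ?_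
    refine tendsto_neg_atTop_atBot.comp ?_
    exact (tendsto_pow_atTop two_ne_zero).atTop_mul_const hs.1

theorem integrable_exp_neg_mul_sq_mul_cos {η : ℝ} (hη : 0 < η) (x : ℝ) :
    Integrable fun t : ℝ => Real.exp (-η * t ^ 2) * Real.cos (t ^ 3 / 3 + (x - η ^ 2) * t) := by
  refine (integrable_exp_neg_mul_sq hη).mono' (Continuous.aestronglyMeasurable (by fun_prop)) ?_
  refine Eventually.of_forall fun t => ?_
  rw [norm_mul, Real.norm_eq_abs, Real.abs_exp]
  exact mul_le_of_le_one_right (Real.exp_pos _).le (Real.abs_cos_le_one _)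

/-- Cauchy's theorem on the rectangle between heights `0` and `η` replaces the conditionally
convergent integral by a Gaussian-damped one. -/
theorem tendsto_integral_cos_cubic (x : ℝ) {η : ℝ} (hη : 0 < η) :
    Tendsto (fun R : ℝ => ∫ t in (0 : ℝ)..R, Real.cos (t ^ 3 / 3 + x * t)) atTop
      (𝓝 (1 / 2 * (Real.exp (η ^ 3 / 3 - x * η) *
        ∫ t, Real.exp (-η * t ^ 2) * Real.cos (t ^ 3 / 3 + (x - η ^ 2) * t)))) := by
  set f : ℂ → ℂ := fun z => Complex.exp (Complex.I * (z ^ 3 / 3 + x * z)) with hf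
  have hcf : Continuous f := continuous_exp_I_mul_cubic x
  have hcauchy : ∀ R : ℝ, (∫ t in (-R)..R, f t) =
      (∫ t in (-R)..R, f (t + η * Complex.I)) -
        Complex.I * (∫ s in (0 : ℝ)..η, f (((R : ℝ) : ℂ) + s * Complex.I)) +
        Complex.I * ∫ s in (0 : ℝ)..η, f (((-R : ℝ) : ℂ) + s * Complex.I) := by
    intro R
    have h := Complex.integral_boundary_rect_eq_zero_of_differentiableOn f (-R : ℝ)
      (R + η * Complex.I) (Differentiable.differentiableOn (by fun_prop))
    simp at h
    push_cast
    linear_combination h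
  have hre : ∀ (a s R : ℝ), (∫ t in a..R, f (t + s * Complex.I)).re =
      Real.exp (s ^ 3 / 3 - x * s) * ∫ t in a..R,
        Real.exp (-s * t ^ 2) * Real.cos (t ^ 3 / 3 + (x - s ^ 2) * t) := by
    intro a s R
    rw [← intervalIntegral.integral_const_mul]
    have := Complex.reCLM.intervalIntegral_comp_comm (a := a) (b := R) (μ := volume)
      (f := fun t : ℝ => f (t + s * Complex.I)) (Continuous.intervalIntegrable (by fun_prop) _ _)
    rw [Complex.reCLM_apply] at this
    rw [← this]
    refine intervalIntegral.integral_congr fun t _ => ?_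
    exact re_exp_I_mul_cubic x t s
  have heven : ∀ R : ℝ, (∫ t in (0 : ℝ)..R, Real.cos (t ^ 3 / 3 + x * t)) =
      1 / 2 * (∫ t in (-R)..R, f t).re := by
    intro R
    have h1 := hre (-R) 0 R
    simp only [Complex.ofReal_zero, zero_mul, add_zero] at h1
    rw [h1]
    simp only [neg_zero, zero_mul, Real.exp_zero, one_mul]
    have hc : Continuous fun t : ℝ => Real.cos (t ^ 3 / 3 + x * t) := by fun_prop
    have h2 := intervalIntegral.integral_add_adjacent_intervals
      (hc.intervalIntegrable (μ := volume) (-R) 0) (hc.intervalIntegrable (μ := volume) 0 R)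
    have h3 : (∫ t in (-R)..0, Real.cos (t ^ 3 / 3 + x * t)) =
        ∫ t in (0 : ℝ)..R, Real.cos (t ^ 3 / 3 + x * t) := by
      have := intervalIntegral.integral_comp_neg (a := 0) (b := R)
        (fun t : ℝ => Real.cos (t ^ 3 / 3 + x * t))
      rw [neg_zero] at this
      rw [← this]
      refine intervalIntegral.integral_congr fun t _ => ?_
      rw [← Real.cos_neg]
      ring_nf
    norm_num
    rw [← h2, h3]
    ring
  have hlim : Tendsto (fun R : ℝ => (∫ t in (-R)..R, f t).re) atTop
      (𝓝 (Real.exp (η ^ 3 / 3 - x * η) *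
        ∫ t, Real.exp (-η * t ^ 2) * Real.cos (t ^ 3 / 3 + (x - η ^ 2) * t))) := by
    have hs1 := tendsto_integral_cubic_side x η hη (l := fun R => R) (fun R => rfl)
    have hs2 := tendsto_integral_cubic_side x η hη (l := fun R => -R) (fun R => by ring)
    have h1 := (Complex.continuous_re.tendsto _).comp (hs1.const_mul Complex.I)
    have h2 := (Complex.continuous_re.tendsto _).comp (hs2.const_mul Complex.I)
    have h3 := (intervalIntegral_tendsto_integral (μ := volume)
      (integrable_exp_neg_mul_sq_mul_cos hη x) tendsto_neg_atTop_atBot tendsto_id).const_mul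
        (Real.exp (η ^ 3 / 3 - x * η))
    have h4 := (h3.sub h1).add h2
    simp only [mul_zero, Complex.zero_re, sub_zero, add_zero] at h4
    refine h4.congr fun R => ?_
    rw [hcauchy R, Complex.add_re, Complex.sub_re, hre]
    rfl
  simp_rw [heven]
  exact hlim.const_mul _

theorem airyAi_eq (x : ℝ) {η : ℝ} (hη : 0 < η) :
    airyAi x = 1 / (2 * Real.pi) * Real.exp (η ^ 3 / 3 - x * η) *
      ∫ t, Real.exp (-η * t ^ 2) * Real.cos (t ^ 3 / 3 + (x - η ^ 2) * t) := by
  refine ((tendsto_integral_cos_cubic x hη).const_mul (1 / Real.pi)).limUnder_eq.trans ?_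
  ring

/-- The contour height is free, so the decay beats every exponential rate; injectivity of the
operator uses this in full. -/
theorem exists_abs_airyAi_le {η : ℝ} (hη : 0 < η) :
    ∃ C, 0 ≤ C ∧ ∀ x, |airyAi x| ≤ C * Real.exp (-(η * x)) := by
  refine ⟨1 / (2 * Real.pi) * Real.exp (η ^ 3 / 3) * ∫ t : ℝ, Real.exp (-η * t ^ 2), ?_, ?_⟩
  · have : 0 ≤ ∫ t : ℝ, Real.exp (-η * t ^ 2) := integral_nonneg fun t => (Real.exp_pos _).le
    positivity
  intro x
  have h : |∫ t, Real.exp (-η * t ^ 2) * Real.cos (t ^ 3 / 3 + (x - η ^ 2) * t)| ≤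
      ∫ t : ℝ, Real.exp (-η * t ^ 2) := by
    rw [← Real.norm_eq_abs]
    refine norm_integral_le_of_norm_le (integrable_exp_neg_mul_sq hη) ?_
    refine Eventually.of_forall fun t => ?_
    rw [norm_mul, Real.norm_eq_abs, Real.abs_exp]
    exact mul_le_of_le_one_right (Real.exp_pos _).le (Real.abs_cos_le_one _)
  rw [airyAi_eq x hη, abs_mul, abs_of_nonneg (by positivity : 0 ≤ 1 / (2 * Real.pi) *
    Real.exp (η ^ 3 / 3 - x * η))]
  have h2 : Real.exp (η ^ 3 / 3 - x * η) = Real.exp (η ^ 3 / 3) * Real.exp (-(η * x)) := by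
    rw [← Real.exp_add]; ring_nf
  calc _ ≤ 1 / (2 * Real.pi) * Real.exp (η ^ 3 / 3 - x * η) *
        ∫ t : ℝ, Real.exp (-η * t ^ 2) := by gcongr
    _ = _ := by rw [h2]; ring

/-- At contour height `√x` the linear phase disappears (saddle point). Rescaling by `ζ = x^(1/4)`
leaves `∫ exp (-u²) cos ((u/ζ)³/3)`, which tends to `√π > 0`. -/
theorem exists_forall_ge_airyAi_ne_zero : ∃ X : ℝ, ∀ x, X ≤ x → airyAi x ≠ 0 := by
  have hlim : Tendsto (fun η : ℝ => ∫ u : ℝ,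
      Real.exp (-u ^ 2) * Real.cos ((u / η) ^ 3 / 3)) atTop
      (𝓝 (∫ u : ℝ, Real.exp (-u ^ 2) * Real.cos ((u * 0) ^ 3 / 3))) := by
    refine tendsto_integral_filter_of_dominated_convergence
      (fun u => Real.exp (-u ^ 2)) ?_ ?_ ?_ ?_
    · exact Eventually.of_forall fun η => Continuous.aestronglyMeasurable (by fun_prop)
    · refine Eventually.of_forall fun η => Eventually.of_forall fun u => ?_
      rw [norm_mul, Real.norm_eq_abs, Real.abs_exp]
      exact mul_le_of_le_one_right (Real.exp_pos _).le (Real.abs_cos_le_one _)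
    · simpa using integrable_exp_neg_mul_sq one_pos
    · refine Eventually.of_forall fun u => ?_
      have hc : Continuous fun v : ℝ => Real.exp (-u ^ 2) * Real.cos ((u * v) ^ 3 / 3) := by
        fun_prop
      exact (hc.tendsto 0).comp tendsto_inv_atTop_zero
  have hpos : 0 < ∫ u : ℝ, Real.exp (-u ^ 2) * Real.cos ((u * 0) ^ 3 / 3) := by
    have := integral_gaussian 1
    simp only [neg_mul, one_mul, div_one] at this
    simp only [mul_zero, ne_eq, OfNat.ofNat_ne_zero, not_false_eq_true, zero_pow, zero_div,
      Real.cos_zero, mul_one, this]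
    exact Real.sqrt_pos.2 Real.pi_pos
  have hev : ∀ᶠ η : ℝ in atTop, 0 < η ∧
      0 < ∫ u : ℝ, Real.exp (-u ^ 2) * Real.cos ((u / η) ^ 3 / 3) :=
    (eventually_gt_atTop 0).and (hlim.eventually (lt_mem_nhds hpos))
  obtain ⟨N, hN⟩ := eventually_atTop.1 hev
  set M := max N 1 with hM
  have hM1 : 1 ≤ M := le_max_right _ _
  refine ⟨M ^ 4, fun x hx => ?_⟩
  have hx1 : 1 ≤ x := (one_le_pow₀ hM1).trans hx
  set ζ := √(√x) with hζ
  have hMζ : M ≤ ζ := by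
    refine Real.le_sqrt_of_sq_le (Real.le_sqrt_of_sq_le ?_)
    calc (M ^ 2) ^ 2 = M ^ 4 := by ring
      _ ≤ x := hx
  have hζ2 : ζ ^ 2 = √x := Real.sq_sqrt (Real.sqrt_nonneg x)
  have hζ4 : (ζ ^ 2) ^ 2 = x := by rw [hζ2, Real.sq_sqrt (by linarith)]
  obtain ⟨hζ0, hI⟩ := hN ζ ((le_max_left _ _).trans hMζ)
  rw [airyAi_eq x (pow_pos hζ0 2)]
  refine mul_ne_zero (by positivity) ?_
  have hsub := Measure.integral_comp_mul_left
    (fun u : ℝ => Real.exp (-u ^ 2) * Real.cos ((u / ζ) ^ 3 / 3)) ζ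
  have hcongr : (∫ t, Real.exp (-ζ ^ 2 * t ^ 2) *
      Real.cos (t ^ 3 / 3 + (x - (ζ ^ 2) ^ 2) * t)) =
      ∫ t : ℝ, Real.exp (-(ζ * t) ^ 2) * Real.cos ((ζ * t / ζ) ^ 3 / 3) := by
    refine integral_congr_ae (Eventually.of_forall fun t => ?_)
    simp only
    rw [hζ4, sub_self, zero_mul, add_zero, mul_div_cancel_left₀ _ hζ0.ne']
    ring_nf
  rw [hcongr, hsub, smul_eq_mul]
  exact (mul_pos (abs_pos.2 (inv_ne_zero hζ0.ne')) hI).ne'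

/-! ### The Airy equation and bounds for `airyAi` and its derivative. -/

theorem hasDerivAt_integral_mul_cos {w p : ℝ → ℝ} (hw : Continuous w) (hp : Continuous p)
    (h0 : Integrable w) (h1 : Integrable fun t => t * w t) (x : ℝ) :
    HasDerivAt (fun x => ∫ t, w t * Real.cos (p t + x * t))
      (-∫ t, t * w t * Real.sin (p t + x * t)) x := by
  rw [← integral_neg]
  refine (hasDerivAt_integral_of_dominated_loc_of_deriv_le (bound := fun t => ‖t * w t‖)
    (F := fun x t => w t * Real.cos (p t + x * t))
    (F' := fun x t => -(t * w t * Real.sin (p t + x * t)))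
    (Filter.univ_mem) (Eventually.of_forall fun y => Continuous.aestronglyMeasurable (by fun_prop))
    ?_ (Continuous.aestronglyMeasurable (by fun_prop)) ?_ h1.norm ?_).2
  · refine h0.norm.mono' (Continuous.aestronglyMeasurable (by fun_prop))
      (Eventually.of_forall fun t => ?_)
    rw [norm_mul]
    exact mul_le_of_le_one_right (norm_nonneg _) (Real.abs_cos_le_one _)
  · refine Eventually.of_forall fun t y _ => ?_
    rw [norm_neg, norm_mul]
    exact mul_le_of_le_one_right (norm_nonneg _) (Real.abs_sin_le_one _)
  · refine Eventually.of_forall fun t y _ => ?_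
    have := (((hasDerivAt_id y).mul_const t).const_add (p t)).cos.const_mul (w t)
    refine this.congr_deriv ?_
    simp only [id]
    ring

theorem hasDerivAt_integral_mul_sin {w p : ℝ → ℝ} (hw : Continuous w) (hp : Continuous p)
    (h0 : Integrable w) (h1 : Integrable fun t => t * w t) (x : ℝ) :
    HasDerivAt (fun x => ∫ t, w t * Real.sin (p t + x * t))
      (∫ t, t * w t * Real.cos (p t + x * t)) x := by
  refine (hasDerivAt_integral_of_dominated_loc_of_deriv_le (bound := fun t => ‖t * w t‖)
    (F := fun x t => w t * Real.sin (p t + x * t))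
    (F' := fun x t => t * w t * Real.cos (p t + x * t))
    (Filter.univ_mem) (Eventually.of_forall fun y => Continuous.aestronglyMeasurable (by fun_prop))
    ?_ (Continuous.aestronglyMeasurable (by fun_prop)) ?_ h1.norm ?_).2
  · refine h0.norm.mono' (Continuous.aestronglyMeasurable (by fun_prop))
      (Eventually.of_forall fun t => ?_)
    rw [norm_mul]
    exact mul_le_of_le_one_right (norm_nonneg _) (Real.abs_sin_le_one _)
  · refine Eventually.of_forall fun t y _ => ?_
    rw [norm_mul]
    exact mul_le_of_le_one_right (norm_nonneg _) (Real.abs_cos_le_one _)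
  · refine Eventually.of_forall fun t y _ => ?_
    have := (((hasDerivAt_id y).mul_const t).const_add (p t)).sin.const_mul (w t)
    refine this.congr_deriv ?_
    simp only [id]
    ring

theorem integrable_pow_mul_exp_neg_sq (n : ℕ) :
    Integrable fun t : ℝ => t ^ n * Real.exp (-t ^ 2) := by
  have := integrable_rpow_mul_exp_neg_mul_sq one_pos (s := n)
    (lt_of_lt_of_le (by norm_num) (Nat.cast_nonneg n))
  simpa using this

/-- Contour height `1` gives cosine and sine integrals `B`, `S` with Gaussian weights, which may be
differentiated under the integral sign. Their first-order system encodes `Ai'' = x Ai`. -/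
theorem airyAi_ode_aux : ∃ B S : ℝ → ℝ, ∃ M K : ℝ,
    (∀ x, airyAi x = K * Real.exp (-x) * B x) ∧ (∀ x, |B x| ≤ M) ∧ (∀ x, |S x| ≤ M) ∧
    (∀ x, HasDerivAt B (-S x) x) ∧ (∀ x, HasDerivAt S (2 * S x - (x - 1) * B x) x) := by
  have hi (n : ℕ) := integrable_pow_mul_exp_neg_sq n
  have i0 : Integrable fun t : ℝ => Real.exp (-t ^ 2) := by simpa using hi 0
  have i1 : Integrable fun t : ℝ => t * Real.exp (-t ^ 2) := by simpa using hi 1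
  have i2 : Integrable fun t : ℝ => t * (t * Real.exp (-t ^ 2)) := by
    simpa only [pow_two, mul_assoc] using hi 2
  set p : ℝ → ℝ := fun t => t ^ 3 / 3 - t with hp
  have cp : Continuous p := by fun_prop
  have ic (w : ℝ → ℝ) (x : ℝ) (hw : Integrable w) :
      Integrable fun t => w t * Real.cos (p t + x * t) := by
    refine hw.norm.mono' (hw.aestronglyMeasurable.mul
      (Continuous.aestronglyMeasurable (by fun_prop))) (Eventually.of_forall fun t => ?_)
    rw [norm_mul]
    exact mul_le_of_le_one_right (norm_nonneg _) (Real.abs_cos_le_one _)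
  have is (w : ℝ → ℝ) (x : ℝ) (hw : Integrable w) :
      Integrable fun t => w t * Real.sin (p t + x * t) := by
    refine hw.norm.mono' (hw.aestronglyMeasurable.mul
      (Continuous.aestronglyMeasurable (by fun_prop))) (Eventually.of_forall fun t => ?_)
    rw [norm_mul]
    exact mul_le_of_le_one_right (norm_nonneg _) (Real.abs_sin_le_one _)
  refine ⟨fun x => ∫ t, Real.exp (-t ^ 2) * Real.cos (p t + x * t),
    fun x => ∫ t, t * Real.exp (-t ^ 2) * Real.sin (p t + x * t),
    max (∫ t : ℝ, ‖Real.exp (-t ^ 2)‖) (∫ t : ℝ, ‖t * Real.exp (-t ^ 2)‖),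
    1 / (2 * Real.pi) * Real.exp (1 / 3), fun x => ?_, fun x => ?_, fun x => ?_, fun x => ?_,
    fun x => ?_⟩
  · rw [airyAi_eq x one_pos, sub_eq_add_neg, Real.exp_add]
    simp only [neg_mul, one_mul, mul_one, one_pow, ← mul_assoc]
    congr 1
    refine integral_congr_ae (Eventually.of_forall fun t => ?_)
    simp only [hp]
    ring_nf
  · refine le_trans ?_ (le_max_left _ _)
    rw [← Real.norm_eq_abs]
    refine norm_integral_le_of_norm_le i0.norm (Eventually.of_forall fun t => ?_)
    rw [norm_mul]
    exact mul_le_of_le_one_right (norm_nonneg _) (Real.abs_cos_le_one _)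
  · refine le_trans ?_ (le_max_right _ _)
    rw [← Real.norm_eq_abs]
    refine norm_integral_le_of_norm_le i1.norm (Eventually.of_forall fun t => ?_)
    rw [norm_mul]
    exact mul_le_of_le_one_right (norm_nonneg _) (Real.abs_sin_le_one _)
  · exact hasDerivAt_integral_mul_cos (by fun_prop) cp i0 i1 x
  · have h := hasDerivAt_integral_mul_sin (w := fun t => t * Real.exp (-t ^ 2))
      (by fun_prop) cp i1 i2 x
    refine h.congr_deriv ?_
    -- The integrand is the total derivative of `exp (-t²) sin (p t + x t)`; this trades the `t²`
    -- moment for `S` and `B`.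
    have hz : ∫ t, (t * (t * Real.exp (-t ^ 2)) * Real.cos (p t + x * t) +
        (x - 1) * (Real.exp (-t ^ 2) * Real.cos (p t + x * t)) -
        2 * (t * Real.exp (-t ^ 2) * Real.sin (p t + x * t))) = 0 := by
      refine integral_eq_zero_of_hasDerivAt_of_integrable
        (f := fun t => Real.exp (-t ^ 2) * Real.sin (p t + x * t)) (fun t => ?_) ?_ (is _ x i0)
      · have h1 : HasDerivAt (fun t : ℝ => Real.exp (-t ^ 2)) (Real.exp (-t ^ 2) * (-(2 * t))) t := by
          simpa using ((hasDerivAt_pow 2 t).neg).exp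
        have h2 : HasDerivAt (fun t : ℝ => p t + x * t) (t ^ 2 - 1 + x) t := by
          have h3 := (((hasDerivAt_pow 3 t).div_const 3).sub (hasDerivAt_id t)).add
            ((hasDerivAt_id t).const_mul x)
          exact h3.congr_deriv (by norm_num)
        refine (h1.mul h2.sin).congr_deriv ?_
        ring
      · exact ((ic _ x i2).add ((ic _ x i0).const_mul _)).sub ((is _ x i1).const_mul _)
    have e1 := integral_sub ((ic _ x i2).add ((ic _ x i0).const_mul (x - 1)))
      ((is _ x i1).const_mul 2)
    have e2 := integral_add (ic _ x i2) ((ic _ x i0).const_mul (x - 1))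
    simp only [Pi.add_apply] at e1
    rw [e1, e2, integral_const_mul, integral_const_mul] at hz
    simp only
    linarith

theorem hasDerivAt_airyAi_and_deriv (x : ℝ) :
    HasDerivAt airyAi (deriv airyAi x) x ∧ HasDerivAt (deriv airyAi) (x * airyAi x) x := by
  obtain ⟨B, S, M, K, hA, -, -, hB, hS⟩ := airyAi_ode_aux
  have hA' : airyAi = fun x => K * Real.exp (-x) * B x := funext hA
  have he (x : ℝ) : HasDerivAt (fun x : ℝ => K * Real.exp (-x)) (K * -Real.exp (-x)) x := by
    simpa using ((hasDerivAt_id x).neg.exp).const_mul K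
  have h1 (x : ℝ) : HasDerivAt airyAi (K * Real.exp (-x) * (-S x - B x)) x := by
    rw [hA']
    refine ((he x).mul (hB x)).congr_deriv ?_
    ring
  have h2 : deriv airyAi = fun x => K * Real.exp (-x) * (-S x - B x) := funext fun x => (h1 x).deriv
  refine ⟨h2 ▸ h1 x, ?_⟩
  rw [h2, hA x]
  refine ((he x).mul ((hS x).neg.sub (hB x))).congr_deriv ?_
  simp only [Pi.sub_apply, Pi.neg_apply]
  ring

theorem hasDerivAt_airyAi (x : ℝ) : HasDerivAt airyAi (deriv airyAi x) x :=
  (hasDerivAt_airyAi_and_deriv x).1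

theorem hasDerivAt_deriv_airyAi (x : ℝ) : HasDerivAt (deriv airyAi) (x * airyAi x) x :=
  (hasDerivAt_airyAi_and_deriv x).2

theorem exists_airyAi_deriv_bound : ∃ C, 0 < C ∧ ∀ x, |airyAi x| ≤ C * Real.exp (-x) ∧
    |deriv airyAi x| ≤ C * Real.exp (-x) := by
  obtain ⟨B, S, M, K, hA, hBM, hSM, hB, hS⟩ := airyAi_ode_aux
  have hA' : airyAi = fun x => K * Real.exp (-x) * B x := funext hA
  have he (x : ℝ) : HasDerivAt (fun x : ℝ => K * Real.exp (-x)) (K * -Real.exp (-x)) x := by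
    simpa using ((hasDerivAt_id x).neg.exp).const_mul K
  have h1 (x : ℝ) : deriv airyAi x = K * Real.exp (-x) * (-S x - B x) := by
    rw [hA']
    refine HasDerivAt.deriv ?_
    refine ((he x).mul (hB x)).congr_deriv ?_
    ring
  have hM : 0 ≤ M := (abs_nonneg _).trans (hBM 0)
  refine ⟨|K| * (2 * M) + 1, by positivity, fun x => ⟨?_, ?_⟩⟩
  · rw [hA, abs_mul, abs_mul, Real.abs_exp]
    have h2 : |B x| ≤ 2 * M := by linarith [hBM x]
    calc _ ≤ |K| * Real.exp (-x) * (2 * M) := by gcongr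
      _ ≤ _ := by nlinarith [Real.exp_pos (-x)]
  · rw [h1, abs_mul, abs_mul, Real.abs_exp]
    have h2 : |-S x - B x| ≤ 2 * M := by
      have h3 := abs_sub (-S x) (B x)
      rw [abs_neg] at h3
      linarith [hBM x, hSM x]
    calc _ ≤ |K| * Real.exp (-x) * (2 * M) := by gcongr
      _ ≤ _ := by nlinarith [Real.exp_pos (-x)]

@[fun_prop]
theorem continuous_airyAi : Continuous airyAi :=
  continuous_iff_continuousAt.2 fun x => (hasDerivAt_airyAi x).continuousAt

@[fun_prop]
theorem continuous_deriv_airyAi : Continuous (deriv airyAi) :=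
  continuous_iff_continuousAt.2 fun x => (hasDerivAt_deriv_airyAi x).continuousAt

/-! ### Exponentially decaying functions and integration by parts on the half-line. -/

theorem integrable_halfLine_iff {f : ℝ → ℝ} :
    Integrable f halfLine ↔ IntegrableOn f (Set.Ioi 0) := by
  rw [← integrableOn_Ici_iff_integrableOn_Ioi]; rfl

theorem ae_halfLine_of_forall {p : ℝ → Prop} (h : ∀ x, 0 ≤ x → p x) : ∀ᵐ x ∂halfLine, p x :=
  (ae_restrict_iff' measurableSet_Ici).2 (Eventually.of_forall h)

theorem integrable_pow_mul_exp_neg_mul (k : ℕ) {a : ℝ} (ha : 0 < a) :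
    Integrable (fun x : ℝ => x ^ k * Real.exp (-(a * x))) halfLine := by
  rw [integrable_halfLine_iff]
  have h := integrableOn_rpow_mul_exp_neg_mul_rpow (s := k) (p := 1) (b := a)
    (lt_of_lt_of_le (by norm_num) (Nat.cast_nonneg k)) one_pos ha
  simpa using h

/-- A continuous function whose restriction to the half-line is `O (exp (-x))`. -/
structure ExpDecay (F : ℝ → ℝ) : Prop where
  cont : Continuous F
  bound : ∃ C, ∀ x, 0 ≤ x → |F x| ≤ C * Real.exp (-x)

theorem ExpDecay.integrable_pow_mul {F G : ℝ → ℝ} (hF : ExpDecay F) (hG : ExpDecay G) (k : ℕ) :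
    Integrable (fun x => x ^ k * (F x * G x)) halfLine := by
  obtain ⟨C, hC⟩ := hF.bound
  obtain ⟨D, hD⟩ := hG.bound
  have hc := hF.cont
  have hd := hG.cont
  refine ((integrable_pow_mul_exp_neg_mul k two_pos).const_mul (C * D)).mono'
    (Continuous.aestronglyMeasurable (by fun_prop)) (ae_halfLine_of_forall fun x hx => ?_)
  rw [norm_mul, norm_mul, norm_pow, Real.norm_of_nonneg hx, Real.norm_eq_abs, Real.norm_eq_abs]
  have : Real.exp (-(2 * x)) = Real.exp (-x) * Real.exp (-x) := by rw [← Real.exp_add]; ring_nf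
  calc x ^ k * (|F x| * |G x|) ≤ x ^ k * ((C * Real.exp (-x)) * (D * Real.exp (-x))) := by
        have := (abs_nonneg _).trans (hC x hx)
        gcongr
        · exact hC x hx
        · exact hD x hx
    _ = _ := by rw [this]; ring

theorem ExpDecay.integrable_mul {F G : ℝ → ℝ} (hF : ExpDecay F) (hG : ExpDecay G) :
    Integrable (fun x => F x * G x) halfLine := by
  simpa using hF.integrable_pow_mul hG 0

theorem ExpDecay.integrable_id_mul {F G : ℝ → ℝ} (hF : ExpDecay F) (hG : ExpDecay G) :
    Integrable (fun x => x * F x * G x) halfLine := by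
  simpa [mul_assoc] using hF.integrable_pow_mul hG 1

theorem expDecay_exp : ExpDecay fun x => Real.exp (-x) :=
  ⟨by fun_prop, 1, fun x _ => by simp⟩

theorem ExpDecay.memLp {F : ℝ → ℝ} (hF : ExpDecay F) : MemLp F 2 halfLine := by
  rw [memLp_two_iff_integrable_sq hF.cont.aestronglyMeasurable]
  simpa [pow_two] using hF.integrable_mul hF

theorem ExpDecay.add {F G : ℝ → ℝ} (hF : ExpDecay F) (hG : ExpDecay G) :
    ExpDecay fun x => F x + G x := by
  obtain ⟨C, hC⟩ := hF.bound
  obtain ⟨D, hD⟩ := hG.bound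
  refine ⟨hF.cont.add hG.cont, C + D, fun x hx => (abs_add_le _ _).trans ?_⟩
  rw [add_mul]
  exact add_le_add (hC x hx) (hD x hx)

theorem ExpDecay.const_mul {F : ℝ → ℝ} (hF : ExpDecay F) (a : ℝ) :
    ExpDecay fun x => a * F x := by
  obtain ⟨C, hC⟩ := hF.bound
  refine ⟨hF.cont.const_mul a, |a| * C, fun x hx => ?_⟩
  rw [abs_mul, mul_assoc]
  exact mul_le_mul_of_nonneg_left (hC x hx) (abs_nonneg a)

theorem ExpDecay.mul_tendsto_zero {F G : ℝ → ℝ} (hF : ExpDecay F) (hG : ExpDecay G) :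
    Tendsto (fun x => F x * G x) atTop (𝓝 0) := by
  obtain ⟨C, hC⟩ := hF.bound
  obtain ⟨D, hD⟩ := hG.bound
  have h1 : Tendsto (fun x => (C * Real.exp (-x)) * (D * Real.exp (-x))) atTop (𝓝 0) := by
    have h2 (A : ℝ) : Tendsto (fun x => A * Real.exp (-x)) atTop (𝓝 0) := by
      simpa using Real.tendsto_exp_neg_atTop_nhds_zero.const_mul A
    simpa using (h2 C).mul (h2 D)
  refine squeeze_zero_norm' ?_ h1
  filter_upwards [eventually_ge_atTop 0] with x hx
  rw [norm_mul, Real.norm_eq_abs, Real.norm_eq_abs]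
  have := (abs_nonneg _).trans (hC x hx)
  gcongr
  · exact hC x hx
  · exact hD x hx

/-- Integration by parts on the half-line. -/
theorem ExpDecay.integral_deriv_mul {F G F' G' : ℝ → ℝ} (hF : ExpDecay F) (hG : ExpDecay G)
    (hF' : ExpDecay F') (hG' : ExpDecay G') (dF : ∀ x, HasDerivAt F (F' x) x)
    (dG : ∀ x, HasDerivAt G (G' x) x) :
    ∫ x, F' x * G x ∂halfLine = -(F 0 * G 0) - ∫ x, F x * G' x ∂halfLine := by
  have h := integral_Ioi_of_hasDerivAt_of_tendsto' (a := 0) (m := 0)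
    (f := fun x => F x * G x) (fun x _ => (dF x).mul (dG x))
    (integrable_halfLine_iff.1 ((hF'.integrable_mul hG).add (hF.integrable_mul hG')))
    (hF.mul_tendsto_zero hG)
  rw [← integral_Ici_eq_integral_Ioi] at h
  change ∫ x, (F' x * G x + F x * G' x) ∂halfLine = _ at h
  rw [integral_add (hF'.integrable_mul hG) (hF.integrable_mul hG')] at h
  linarith

/-! ### Integrals against translated kernels: differentiation and symmetry. -/

theorem MeasureTheory.MemLp.integrable_mul_pow_mul_exp_neg {f : ℝ → ℝ}
    (hf : MemLp f 2 halfLine) (k : ℕ) :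
    Integrable (fun y => y ^ k * f y * Real.exp (-y)) halfLine := by
  have h : MemLp (fun y : ℝ => y ^ k * Real.exp (-y)) 2 halfLine := by
    rw [memLp_two_iff_integrable_sq (Continuous.aestronglyMeasurable (by fun_prop))]
    refine (integrable_pow_mul_exp_neg_mul (k * 2) two_pos).congr (Eventually.of_forall fun y => ?_)
    simp only
    rw [mul_pow, ← pow_mul, ← Real.exp_nat_mul]
    ring_nf
  refine (hf.integrable_mul h).congr (Eventually.of_forall fun y => ?_)
  simp only [Pi.mul_apply]
  ring

theorem MeasureTheory.MemLp.integrable_mul_exp_neg {f : ℝ → ℝ}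
    (hf : MemLp f 2 halfLine) : Integrable (fun y => f y * Real.exp (-y)) halfLine := by
  simpa using hf.integrable_mul_pow_mul_exp_neg 0

theorem aestronglyMeasurable_of_integrable_mul_exp_neg {f : ℝ → ℝ}
    (hf : Integrable (fun y => f y * Real.exp (-y)) halfLine) :
    AEStronglyMeasurable f halfLine := by
  have h := hf.aestronglyMeasurable.mul
    (Continuous.aestronglyMeasurable (f := fun y : ℝ => Real.exp y) (μ := halfLine) (by fun_prop))
  refine h.congr (Eventually.of_forall fun y => ?_)
  simp [mul_assoc, ← Real.exp_add]

theorem norm_mul_shift_le {a f : ℝ → ℝ} {C : ℝ} (hC : ∀ x, |a x| ≤ C * Real.exp (-x))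
    (s y : ℝ) : ‖a (s + y) * f y‖ ≤ C * Real.exp (-s) * ‖f y * Real.exp (-y)‖ := by
  rw [norm_mul, norm_mul, Real.norm_eq_abs, Real.norm_eq_abs, Real.norm_eq_abs (Real.exp _),
    Real.abs_exp]
  calc |a (s + y)| * |f y| ≤ C * Real.exp (-(s + y)) * |f y| :=
        mul_le_mul_of_nonneg_right (hC _) (abs_nonneg _)
    _ = _ := by rw [neg_add, Real.exp_add]; ring

theorem integrable_shift_mul {a f : ℝ → ℝ} {C : ℝ} (ha : Continuous a)
    (hC : ∀ x, |a x| ≤ C * Real.exp (-x))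
    (hf : Integrable (fun y => f y * Real.exp (-y)) halfLine) (s : ℝ) :
    Integrable (fun y => a (s + y) * f y) halfLine :=
  (hf.norm.const_mul (C * Real.exp (-s))).mono'
    ((Continuous.aestronglyMeasurable (by fun_prop)).mul
      (aestronglyMeasurable_of_integrable_mul_exp_neg hf))
    (Eventually.of_forall fun y => norm_mul_shift_le hC s y)

theorem abs_integral_shift_mul_le {a f : ℝ → ℝ} {C : ℝ}
    (hC : ∀ x, |a x| ≤ C * Real.exp (-x))
    (hf : Integrable (fun y => f y * Real.exp (-y)) halfLine) (s : ℝ) :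
    |∫ y, a (s + y) * f y ∂halfLine| ≤
      C * (∫ y, ‖f y * Real.exp (-y)‖ ∂halfLine) * Real.exp (-s) := by
  rw [mul_right_comm, ← integral_const_mul]
  exact norm_integral_le_of_norm_le (hf.norm.const_mul _)
    (Eventually.of_forall fun y => norm_mul_shift_le hC s y)

/-- The factor `1 + y` in the bound on `a'` is there for `a = Ai'`, where `a' x = x Ai x`. -/
theorem hasDerivAt_integral_shift_mul {a a' f : ℝ → ℝ} {C : ℝ}
    (da : ∀ x, HasDerivAt a (a' x) x) (ha' : Continuous a')
    (hC : ∀ x, |a x| ≤ C * Real.exp (-x)) {s : ℝ}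
    {D : ℝ} (hD : ∀ x ∈ Metric.ball s 1, ∀ y, 0 ≤ y →
      |a' (x + y)| ≤ D * ((1 + y) * Real.exp (-y)))
    (hf : Integrable (fun y => f y * Real.exp (-y)) halfLine)
    (hf1 : Integrable (fun y => (1 + y) * f y * Real.exp (-y)) halfLine) :
    HasDerivAt (fun s => ∫ y, a (s + y) * f y ∂halfLine)
      (∫ y, a' (s + y) * f y ∂halfLine) s := by
  have ha : Continuous a := continuous_iff_continuousAt.2 fun x => (da x).continuousAt
  have hm := aestronglyMeasurable_of_integrable_mul_exp_neg hf
  refine (hasDerivAt_integral_of_dominated_loc_of_deriv_le (μ := halfLine)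
    (F := fun s y => a (s + y) * f y) (F' := fun s y => a' (s + y) * f y)
    (bound := fun y => D * ‖(1 + y) * f y * Real.exp (-y)‖)
    (Metric.ball_mem_nhds s one_pos)
    (Eventually.of_forall fun x => (integrable_shift_mul ha hC hf x).aestronglyMeasurable)
    (integrable_shift_mul ha hC hf s)
    ((Continuous.aestronglyMeasurable (by fun_prop)).mul hm) ?_ (hf1.norm.const_mul D) ?_).2
  · refine ae_halfLine_of_forall fun y hy x hx => ?_
    rw [norm_mul, norm_mul, norm_mul, Real.norm_eq_abs, Real.norm_eq_abs (Real.exp _),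
      Real.abs_exp, Real.norm_of_nonneg (by linarith : 0 ≤ 1 + y)]
    calc |a' (x + y)| * ‖f y‖ ≤ D * ((1 + y) * Real.exp (-y)) * ‖f y‖ :=
          mul_le_mul_of_nonneg_right (hD x hx y hy) (norm_nonneg _)
      _ = _ := by ring
  · refine Eventually.of_forall fun y x _ => ?_
    exact ((da (x + y)).comp_add_const x y).mul_const (f y)

theorem airyOp_eq (c : ℝ) (f : ℝ → ℝ) (x : ℝ) :
    airyOp c f x = ∫ y, airyAi (x + c + y) * f y ∂halfLine := by
  simp only [airyOp, add_right_comm]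

theorem hasDerivAt_integral_airyAi {f : ℝ → ℝ}
    (hf : Integrable (fun y => f y * Real.exp (-y)) halfLine)
    (hf1 : Integrable (fun y => y * f y * Real.exp (-y)) halfLine) (s : ℝ) :
    HasDerivAt (fun s => ∫ y, airyAi (s + y) * f y ∂halfLine)
      (∫ y, deriv airyAi (s + y) * f y ∂halfLine) s := by
  obtain ⟨C, hC0, hC⟩ := exists_airyAi_deriv_bound
  refine hasDerivAt_integral_shift_mul hasDerivAt_airyAi continuous_deriv_airyAi
    (fun x => (hC x).1) (D := C * Real.exp (1 - s)) (fun x hx y hy => ?_) hf ?_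
  · rw [Metric.mem_ball, Real.dist_eq] at hx
    refine ((hC _).2).trans ?_
    rw [mul_assoc]
    refine mul_le_mul_of_nonneg_left ?_ hC0.le
    have h1 : Real.exp (-(x + y)) ≤ Real.exp (1 - s) * Real.exp (-y) := by
      rw [← Real.exp_add]
      exact Real.exp_le_exp.2 (by linarith [(abs_lt.1 hx).1])
    have h2 : Real.exp (-y) ≤ (1 + y) * Real.exp (-y) :=
      le_mul_of_one_le_left (Real.exp_pos _).le (by linarith)
    exact h1.trans (mul_le_mul_of_nonneg_left h2 (Real.exp_pos _).le)
  · refine (hf.add hf1).congr (Eventually.of_forall fun y => ?_)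
    simp only [Pi.add_apply]
    ring

theorem hasDerivAt_integral_deriv_airyAi {f : ℝ → ℝ}
    (hf : Integrable (fun y => f y * Real.exp (-y)) halfLine)
    (hf1 : Integrable (fun y => y * f y * Real.exp (-y)) halfLine) (s : ℝ) :
    HasDerivAt (fun s => ∫ y, deriv airyAi (s + y) * f y ∂halfLine)
      (s * (∫ y, airyAi (s + y) * f y ∂halfLine) + ∫ y, airyAi (s + y) * (y * f y) ∂halfLine)
      s := by
  obtain ⟨C, hC0, hC⟩ := exists_airyAi_deriv_bound
  have h := hasDerivAt_integral_shift_mul (f := f) (s := s) hasDerivAt_deriv_airyAi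
    (continuous_id.mul continuous_airyAi)
    (fun x => (hC x).2) (D := (|s| + 1) * (C * Real.exp (1 - s))) (fun x hx y hy => ?_) hf ?_
  · refine h.congr_deriv ?_
    rw [← integral_const_mul, ← integral_add]
    · refine integral_congr_ae (Eventually.of_forall fun y => ?_)
      simp only
      ring
    · exact (integrable_shift_mul continuous_airyAi (fun x => (hC x).1) hf s).const_mul s
    · exact integrable_shift_mul continuous_airyAi (fun x => (hC x).1) hf1 s
  · rw [Metric.mem_ball, Real.dist_eq] at hx
    have h1 : |airyAi (x + y)| ≤ C * Real.exp (1 - s) * Real.exp (-y) := by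
      refine ((hC _).1).trans ?_
      rw [mul_assoc, ← Real.exp_add]
      refine mul_le_mul_of_nonneg_left (Real.exp_le_exp.2 ?_) hC0.le
      linarith [(abs_lt.1 hx).1]
    have h2 : |x + y| ≤ (|s| + 1) * (1 + y) := by
      have h3 : |x| ≤ |s| + 1 := by
        have := abs_sub_abs_le_abs_sub x s
        linarith
      have h4 := abs_add_le x y
      rw [abs_of_nonneg hy] at h4
      nlinarith [abs_nonneg s]
    rw [abs_mul]
    calc |x + y| * |airyAi (x + y)|
        ≤ ((|s| + 1) * (1 + y)) * (C * Real.exp (1 - s) * Real.exp (-y)) := by gcongr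
      _ = _ := by ring
  · refine (hf.add hf1).congr (Eventually.of_forall fun y => ?_)
    simp only [Pi.add_apply]
    ring

theorem integral_airyOp_mul {f g : ℝ → ℝ} (c : ℝ)
    (hf : Integrable (fun y => f y * Real.exp (-y)) halfLine)
    (hg : Integrable (fun y => g y * Real.exp (-y)) halfLine) :
    ∫ x, airyOp c f x * g x ∂halfLine = ∫ x, f x * airyOp c g x ∂halfLine := by
  obtain ⟨C, hC0, hC⟩ := exists_airyAi_deriv_bound
  have : SFinite halfLine := by unfold halfLine; infer_instance
  have hint : Integrable (fun p : ℝ × ℝ => airyAi (p.1 + p.2 + c) * f p.2 * g p.1)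
      (halfLine.prod halfLine) := by
    refine ((hg.norm.mul_prod hf.norm).const_mul (C * Real.exp (-c))).mono' ?_ ?_
    · refine AEStronglyMeasurable.mul (AEStronglyMeasurable.mul
        (Continuous.aestronglyMeasurable (by fun_prop)) ?_) ?_
      · exact (aestronglyMeasurable_of_integrable_mul_exp_neg hf).comp_snd
      · exact (aestronglyMeasurable_of_integrable_mul_exp_neg hg).comp_fst
    · refine Eventually.of_forall fun p => ?_
      simp only [norm_mul, Real.norm_eq_abs, Real.abs_exp]
      calc |airyAi (p.1 + p.2 + c)| * |f p.2| * |g p.1|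
          ≤ C * Real.exp (-(p.1 + p.2 + c)) * |f p.2| * |g p.1| := by
            gcongr
            exact (hC _).1
        _ = _ := by rw [neg_add, neg_add, Real.exp_add, Real.exp_add]; ring
  calc ∫ x, airyOp c f x * g x ∂halfLine
      = ∫ x, ∫ y, airyAi (x + y + c) * f y * g x ∂halfLine ∂halfLine := by
        simp only [airyOp, integral_mul_const]
    _ = ∫ y, ∫ x, airyAi (x + y + c) * f y * g x ∂halfLine ∂halfLine :=
        integral_integral_swap hint
    _ = _ := by
        refine integral_congr_ae (Eventually.of_forall fun y => ?_)
        simp only [airyOp, ← integral_const_mul]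
        refine integral_congr_ae (Eventually.of_forall fun x => ?_)
        simp only
        rw [add_comm x y]
        ring

/-! ### Regularity and integral identities for eigenfunctions. -/

/-- An eigenfunction of the Airy operator extended to the whole line by the eigenvalue equation
(or the zero function). -/
structure IsAiryEigenfun (c μ : ℝ) (F : ℝ → ℝ) : Prop where
  memLp : MemLp F 2 halfLine
  eigen : ∀ x : ℝ, μ * F x = airyOp c F x

theorem integrable_airyAi_shift_mul {f : ℝ → ℝ}
    (hf : Integrable (fun y => f y * Real.exp (-y)) halfLine) (s : ℝ) :
    Integrable (fun y => airyAi (s + y) * f y) halfLine := by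
  obtain ⟨C, hC0, hC⟩ := exists_airyAi_deriv_bound
  exact integrable_shift_mul continuous_airyAi (fun x => (hC x).1) hf s

theorem expDecay_airyAi_shift (s : ℝ) : ExpDecay fun y => airyAi (s + y) := by
  obtain ⟨C, hC0, hC⟩ := exists_airyAi_deriv_bound
  refine ⟨by fun_prop, C * Real.exp (-s), fun y _ => ((hC _).1).trans_eq ?_⟩
  rw [neg_add, Real.exp_add, mul_assoc]

theorem expDecay_deriv_airyAi_shift (s : ℝ) : ExpDecay fun y => deriv airyAi (s + y) := by
  obtain ⟨C, hC0, hC⟩ := exists_airyAi_deriv_bound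
  refine ⟨by fun_prop, C * Real.exp (-s), fun y _ => ((hC _).2).trans_eq ?_⟩
  rw [neg_add, Real.exp_add, mul_assoc]

theorem airyOp_congr {c : ℝ} {f g : ℝ → ℝ} (h : f =ᵐ[halfLine] g) (x : ℝ) :
    airyOp c f x = airyOp c g x :=
  integral_congr_ae (h.mono fun y hy => by simp only [hy])

theorem airyOp_const_mul (c a : ℝ) (f : ℝ → ℝ) (x : ℝ) :
    airyOp c (fun y => a * f y) x = a * airyOp c f x := by
  simp only [airyOp, ← integral_const_mul]
  congr 1 with y
  ring

theorem airyOp_add {c : ℝ} {f g : ℝ → ℝ} (hf : MemLp f 2 halfLine) (hg : MemLp g 2 halfLine)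
    (x : ℝ) : airyOp c (fun y => f y + g y) x = airyOp c f x + airyOp c g x := by
  simp only [airyOp_eq]
  rw [← integral_add (integrable_airyAi_shift_mul hf.integrable_mul_exp_neg _)
    (integrable_airyAi_shift_mul hg.integrable_mul_exp_neg _)]
  congr 1 with y
  ring

namespace IsAiryEigenfun

variable {c μ : ℝ} {F : ℝ → ℝ}

theorem const_mul (h : IsAiryEigenfun c μ F) (a : ℝ) : IsAiryEigenfun c μ fun x => a * F x :=
  ⟨h.memLp.const_mul a, fun x => by rw [airyOp_const_mul, ← h.eigen]; ring⟩

theorem add {G : ℝ → ℝ} (hF : IsAiryEigenfun c μ F) (hG : IsAiryEigenfun c μ G) :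
    IsAiryEigenfun c μ fun x => F x + G x :=
  ⟨hF.memLp.add hG.memLp, fun x => by rw [airyOp_add hF.memLp hG.memLp, ← hF.eigen, ← hG.eigen,
    mul_add]⟩

theorem eq_integral (h : IsAiryEigenfun c μ F) (hμ : μ ≠ 0) (x : ℝ) :
    F x = μ⁻¹ * ∫ y, airyAi (x + c + y) * F y ∂halfLine := by
  rw [← airyOp_eq, ← h.eigen, inv_mul_cancel_left₀ hμ]

theorem hasDerivAt_integral (h : IsAiryEigenfun c μ F) (hμ : μ ≠ 0) (x : ℝ) :
    HasDerivAt F (μ⁻¹ * ∫ y, deriv airyAi (x + c + y) * F y ∂halfLine) x := by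
  have h1 := (hasDerivAt_integral_airyAi h.memLp.integrable_mul_exp_neg
    (by simpa using h.memLp.integrable_mul_pow_mul_exp_neg 1) (x + c)).comp_add_const x c
  rw [show F = fun x => μ⁻¹ * ∫ y, airyAi (x + c + y) * F y ∂halfLine from
    funext (h.eq_integral hμ)]
  have h2 := h1.const_mul μ⁻¹
  rw [← show F = fun x => μ⁻¹ * ∫ y, airyAi (x + c + y) * F y ∂halfLine from
    funext (h.eq_integral hμ)] at h2 ⊢
  exact h2

theorem deriv_eq (h : IsAiryEigenfun c μ F) (hμ : μ ≠ 0) (x : ℝ) :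
    deriv F x = μ⁻¹ * ∫ y, deriv airyAi (x + c + y) * F y ∂halfLine :=
  (h.hasDerivAt_integral hμ x).deriv

theorem hasDerivAt (h : IsAiryEigenfun c μ F) (hμ : μ ≠ 0) (x : ℝ) :
    HasDerivAt F (deriv F x) x := by
  rw [h.deriv_eq hμ]
  exact h.hasDerivAt_integral hμ x

theorem hasDerivAt_deriv (h : IsAiryEigenfun c μ F) (hμ : μ ≠ 0) (x : ℝ) :
    HasDerivAt (deriv F) (μ⁻¹ * ((x + c) * (μ * F x) + airyOp c (fun y => y * F y) x)) x := by
  have h1 := ((hasDerivAt_integral_deriv_airyAi h.memLp.integrable_mul_exp_neg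
    (by simpa using h.memLp.integrable_mul_pow_mul_exp_neg 1) (x + c)).comp_add_const x c).const_mul
      μ⁻¹
  rw [← airyOp_eq, ← airyOp_eq, ← h.eigen] at h1
  rwa [show deriv F = _ from funext (h.deriv_eq hμ)]

theorem exists_bound (h : IsAiryEigenfun c μ F) (hμ : μ ≠ 0) :
    ∃ C, ∀ x, |F x| ≤ C * Real.exp (-x) ∧ |deriv F x| ≤ C * Real.exp (-x) := by
  obtain ⟨C, hC0, hC⟩ := exists_airyAi_deriv_bound
  have key {a : ℝ → ℝ} (ha : ∀ x, |a x| ≤ C * Real.exp (-x)) (x : ℝ) :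
      |μ⁻¹ * ∫ y, a (x + c + y) * F y ∂halfLine| ≤
        |μ⁻¹| * ((C * ∫ y, ‖F y * Real.exp (-y)‖ ∂halfLine) * Real.exp (-c)) * Real.exp (-x) := by
    rw [abs_mul, mul_assoc |μ⁻¹|]
    refine mul_le_mul_of_nonneg_left ?_ (abs_nonneg _)
    refine (abs_integral_shift_mul_le ha h.memLp.integrable_mul_exp_neg (x + c)).trans_eq ?_
    rw [neg_add, Real.exp_add]
    ring
  refine ⟨|μ⁻¹| * ((C * ∫ y, ‖F y * Real.exp (-y)‖ ∂halfLine) * Real.exp (-c)),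
    fun x => ⟨?_, ?_⟩⟩
  · rw [h.eq_integral hμ]
    exact key (fun x => (hC x).1) x
  · rw [h.deriv_eq hμ]
    exact key (fun x => (hC x).2) x

theorem expDecay (h : IsAiryEigenfun c μ F) (hμ : μ ≠ 0) : ExpDecay F :=
  have ⟨C, hC⟩ := h.exists_bound hμ
  ⟨continuous_iff_continuousAt.2 fun x => (h.hasDerivAt hμ x).continuousAt, C,
    fun x _ => (hC x).1⟩

theorem expDecay_deriv (h : IsAiryEigenfun c μ F) (hμ : μ ≠ 0) : ExpDecay (deriv F) :=
  have ⟨C, hC⟩ := h.exists_bound hμ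
  ⟨continuous_iff_continuousAt.2 fun x => (h.hasDerivAt_deriv hμ x).continuousAt, C,
    fun x _ => (hC x).2⟩

/-- The kernel has equal `x`- and `y`-derivatives, so integrating by parts in `y` moves the
derivative onto `F`, with a sign and a boundary term at `0`. When `F 0 = 0`, `F'` satisfies the
eigenvalue equation for `-μ`. -/
theorem mul_deriv_add_airyOp_deriv (h : IsAiryEigenfun c μ F) (hμ : μ ≠ 0) (x : ℝ) :
    μ * deriv F x = -(F 0 * airyAi (x + c)) - airyOp c (deriv F) x := by
  have h1 := ExpDecay.integral_deriv_mul (expDecay_airyAi_shift (x + c)) (h.expDecay hμ)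
    (expDecay_deriv_airyAi_shift (x + c)) (h.expDecay_deriv hμ)
    (fun y => (hasDerivAt_airyAi (x + c + y)).comp_const_add (x + c) y) (h.hasDerivAt hμ)
  rw [h.deriv_eq hμ, mul_inv_cancel_left₀ hμ, h1, airyOp_eq, add_zero]
  ring

theorem deriv_of_zero (h : IsAiryEigenfun c μ F) (hμ : μ ≠ 0) (h0 : F 0 = 0) :
    IsAiryEigenfun c (-μ) (deriv F) :=
  ⟨(h.expDecay_deriv hμ).memLp, fun x => by
    have := h.mul_deriv_add_airyOp_deriv hμ x
    rw [h0] at this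
    linarith⟩

theorem integral_deriv_mul_self (h : IsAiryEigenfun c μ F) (hμ : μ ≠ 0) :
    ∫ x, deriv F x * F x ∂halfLine = -(F 0 ^ 2) / 2 := by
  have h1 := (h.expDecay hμ).integral_deriv_mul (h.expDecay hμ) (h.expDecay_deriv hμ)
    (h.expDecay_deriv hμ) (h.hasDerivAt hμ) (h.hasDerivAt hμ)
  simp only [mul_comm (F _) (deriv F _)] at h1
  linarith

theorem integral_airyOp_mul {g : ℝ → ℝ} (h : IsAiryEigenfun c μ F) (hg : MemLp g 2 halfLine) :
    ∫ x, airyOp c g x * F x ∂halfLine = μ * ∫ x, g x * F x ∂halfLine := by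
  rw [_root_.integral_airyOp_mul c hg.integrable_mul_exp_neg h.memLp.integrable_mul_exp_neg,
    ← integral_const_mul]
  congr 1 with x
  rw [← h.eigen]
  ring

/-- Evaluate `⟪T F', G⟫` twice: symmetry gives `-μ ⟪F', G⟫`, and integration by parts gives the same
plus `μ F(0) G(0)`. -/
theorem mul_zero_of_neg {G : ℝ → ℝ} (hF : IsAiryEigenfun c μ F) (hG : IsAiryEigenfun c (-μ) G)
    (hμ : μ ≠ 0) : F 0 * G 0 = 0 := by
  have hμ' : -μ ≠ 0 := neg_ne_zero.2 hμ
  have dF := hF.expDecay_deriv hμ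
  have dG := hG.expDecay hμ'
  have h1 := hG.integral_airyOp_mul dF.memLp
  have h2 (x : ℝ) : airyOp c (deriv F) x * G x =
      -μ * (deriv F x * G x) - F 0 * (airyAi (c + x) * G x) := by
    have := hF.mul_deriv_add_airyOp_deriv hμ x
    rw [add_comm c x]
    linear_combination (G x) * this
  simp only [h2] at h1
  rw [integral_sub ((dF.integrable_mul dG).const_mul _)
    (((expDecay_airyAi_shift c).integrable_mul dG).const_mul _), integral_const_mul,
    integral_const_mul] at h1
  have h3 : ∫ x, airyAi (c + x) * G x ∂halfLine = -μ * G 0 := by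
    rw [hG.eigen, airyOp_eq, zero_add]
  rw [h3] at h1
  have : μ * (F 0 * G 0) = 0 := by linarith
  exact (mul_eq_zero.1 this).resolve_left hμ

theorem memLp_id_mul (h : IsAiryEigenfun c μ F) (hμ : μ ≠ 0) :
    MemLp (fun y => y * F y) 2 halfLine := by
  have hF := h.expDecay hμ
  have := hF.cont
  rw [memLp_two_iff_integrable_sq (Continuous.aestronglyMeasurable (by fun_prop))]
  refine (hF.integrable_pow_mul hF 2).congr (Eventually.of_forall fun x => ?_)
  simp only
  ring

/-- The second derivative of an eigenfunction, tested against an eigenfunction. -/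
theorem integral_deriv_deriv_mul {G : ℝ → ℝ} {ν : ℝ} (hF : IsAiryEigenfun c μ F)
    (hG : IsAiryEigenfun c ν G) (hμ : μ ≠ 0) (hν : ν ≠ 0) :
    μ * ∫ x, deriv (deriv F) x * G x ∂halfLine =
      (μ + ν) * (∫ x, x * F x * G x ∂halfLine) + μ * c * ∫ x, F x * G x ∂halfLine := by
  have eF := hF.expDecay hμ
  have eG := hG.expDecay hν
  have hm := hF.memLp_id_mul hμ
  have h1 (x : ℝ) : μ * (deriv (deriv F) x * G x) =
      μ * (x * F x * G x) + μ * c * (F x * G x) + airyOp c (fun y => y * F y) x * G x := by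
    rw [(hF.hasDerivAt_deriv hμ x).deriv]
    field_simp
  have hint : Integrable (fun x => airyOp c (fun y => y * F y) x * G x) halfLine := by
    have h2 (x : ℝ) : HasDerivAt (fun s => ∫ y, airyAi (s + y) * (y * F y) ∂halfLine) _ x :=
      hasDerivAt_integral_airyAi hm.integrable_mul_exp_neg
      (by simpa using hm.integrable_mul_pow_mul_exp_neg 1) x
    have hc : Continuous fun s => ∫ y, airyAi (s + y) * (y * F y) ∂halfLine :=
      continuous_iff_continuousAt.2 fun x => (h2 x).continuousAt
    obtain ⟨C, hC0, hC⟩ := exists_airyAi_deriv_bound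
    refine ExpDecay.integrable_mul ⟨?_, C * (∫ y, ‖(y * F y) * Real.exp (-y)‖ ∂halfLine) *
      Real.exp (-c), fun x _ => ?_⟩ eG
    · simp only [funext (airyOp_eq c _)]
      exact hc.comp (continuous_id.add continuous_const)
    · rw [airyOp_eq]
      refine (abs_integral_shift_mul_le (fun x => (hC x).1) hm.integrable_mul_exp_neg
        (x + c)).trans_eq ?_
      rw [neg_add, Real.exp_add]
      ring
  have i1 := (eF.integrable_id_mul eG).const_mul μ
  have i2 := (eF.integrable_mul eG).const_mul (μ * c)
  have e1 := integral_add (i1.add i2) hint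
  have e2 := integral_add i1 i2
  simp only [Pi.add_apply] at e1
  rw [← integral_const_mul]
  simp only [h1]
  -- Symmetry moves `T` from `y F` onto `G`, producing the factor `ν` beside the `μ` coming from
  -- `Ai'' = x Ai`.
  rw [e1, e2, hG.integral_airyOp_mul hm, integral_const_mul, integral_const_mul]
  ring

/-- Test `F''` against `F'`, an eigenfunction for `-μ`: the moment term has coefficient `μ - μ = 0`,
and what remains is `(F' 0)² = c (F 0)² = 0`. -/
theorem deriv_zero_of_zero (h : IsAiryEigenfun c μ F) (hμ : μ ≠ 0) (h0 : F 0 = 0) :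
    deriv F 0 = 0 := by
  have hμ' : -μ ≠ 0 := neg_ne_zero.2 hμ
  have hG := h.deriv_of_zero hμ h0
  have h1 := h.integral_deriv_deriv_mul hG hμ hμ'
  have h2 := h.integral_deriv_mul_self hμ
  have h3 := hG.integral_deriv_mul_self hμ'
  simp only [mul_comm (F _) (deriv F _)] at h1
  rw [h2, h3, h0] at h1
  have : μ * (deriv F 0) ^ 2 = 0 := by linarith
  simpa [hμ] using this

/-- Testing `F''` against `F` gives `-∫ F'² = 2 ∫ x F² + c ∫ F²`, and the moment term is nonnegative
on the half-line. -/
theorem integral_deriv_sq_le (h : IsAiryEigenfun c μ F) (hμ : μ ≠ 0) (h0 : F 0 = 0) :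
    ∫ x, deriv F x ^ 2 ∂halfLine ≤ |c| * ∫ x, F x ^ 2 ∂halfLine := by
  have hμ' : -μ ≠ 0 := neg_ne_zero.2 hμ
  have hG := h.deriv_of_zero hμ h0
  have h1 := h.integral_deriv_deriv_mul h hμ hμ
  have h2 := hG.expDecay hμ' |>.integral_deriv_mul (h.expDecay hμ) (hG.expDecay_deriv hμ')
    (h.expDecay_deriv hμ) (hG.hasDerivAt hμ') (h.hasDerivAt hμ)
  rw [h0, mul_zero, neg_zero, zero_sub] at h2
  rw [h2] at h1
  have h3 : 0 ≤ ∫ x, x * F x * F x ∂halfLine :=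
    integral_nonneg_of_ae (ae_halfLine_of_forall fun x hx => by
      simp only [mul_assoc]
      exact mul_nonneg hx (mul_self_nonneg _))
  have h4 : 0 ≤ ∫ x, F x * F x ∂halfLine := integral_nonneg fun x => mul_self_nonneg _
  simp only [pow_two]
  have h5 : -∫ x, deriv F x * deriv F x ∂halfLine =
      2 * (∫ x, x * F x * F x ∂halfLine) + c * ∫ x, F x * F x ∂halfLine :=
    mul_left_cancel₀ hμ (by linarith)
  nlinarith [neg_abs_le c]

end IsAiryEigenfun

/-! ### Eigenfunctions vanishing at the origin, and simplicity. -/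

/-- A weighted Poincaré inequality. -/
theorem integral_exp_mul_sq_le {F F' : ℝ → ℝ} (hF : ExpDecay F) (hF' : ExpDecay F')
    (dF : ∀ x, HasDerivAt F (F' x) x) (h0 : F 0 = 0) {M : ℝ} (hM : 0 < M) :
    M ^ 2 * ∫ x, Real.exp (-(2 * M * x)) * F x ^ 2 ∂halfLine ≤
      ∫ x, Real.exp (-(2 * M * x)) * F' x ^ 2 ∂halfLine := by
  have hw {G : ℝ → ℝ} (hG : ExpDecay G) : ExpDecay fun x => Real.exp (-(2 * M * x)) * G x := by
    obtain ⟨C, hC⟩ := hG.bound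
    have := hG.cont
    refine ⟨by fun_prop, C, fun x hx => ?_⟩
    rw [abs_mul, Real.abs_exp]
    refine (mul_le_of_le_one_left (abs_nonneg _) (Real.exp_le_one_iff.2 ?_)).trans (hC x hx)
    rw [neg_nonpos]
    positivity
  have dw (x : ℝ) : HasDerivAt (fun x => Real.exp (-(2 * M * x)) * F x)
      (-(2 * M) * (Real.exp (-(2 * M * x)) * F x) + Real.exp (-(2 * M * x)) * F' x) x := by
    have h1 : HasDerivAt (fun x : ℝ => Real.exp (-(2 * M * x)))
        (Real.exp (-(2 * M * x)) * -(2 * M * 1)) x :=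
      ((hasDerivAt_id x).const_mul (2 * M)).neg.exp
    refine (h1.mul (dF x)).congr_deriv ?_
    ring
  have h1 := (hw hF).integral_deriv_mul hF (((hw hF).const_mul _).add (hw hF')) hF' dw dF
  rw [h0, mul_zero, neg_zero, zero_sub] at h1
  have iA : Integrable (fun x => Real.exp (-(2 * M * x)) * F x ^ 2) halfLine :=
    ((hw hF).integrable_mul hF).congr (Eventually.of_forall fun x => by ring)
  have iB : Integrable (fun x => Real.exp (-(2 * M * x)) * F' x ^ 2) halfLine :=
    ((hw hF').integrable_mul hF').congr (Eventually.of_forall fun x => by ring)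
  have iC : Integrable (fun x => Real.exp (-(2 * M * x)) * F x * F' x) halfLine :=
    (hw hF).integrable_mul hF'
  have e1 : ∫ x, (-(2 * M) * (Real.exp (-(2 * M * x)) * F x) +
      Real.exp (-(2 * M * x)) * F' x) * F x ∂halfLine =
      -(2 * M) * (∫ x, Real.exp (-(2 * M * x)) * F x ^ 2 ∂halfLine) +
        ∫ x, Real.exp (-(2 * M * x)) * F x * F' x ∂halfLine := by
    rw [← integral_const_mul, ← integral_add (iA.const_mul _) iC]
    congr 1 with x
    ring
  rw [e1] at h1
  -- Integrate `0 ≤ (M F - F')²` against the weight. Together with `∫ w F F' = M ∫ w F²`, from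
  -- integrating by parts with `F 0 = 0`, this is the inequality.
  have h2 : 2 * M * ∫ x, Real.exp (-(2 * M * x)) * F x * F' x ∂halfLine ≤
      M ^ 2 * (∫ x, Real.exp (-(2 * M * x)) * F x ^ 2 ∂halfLine) +
        ∫ x, Real.exp (-(2 * M * x)) * F' x ^ 2 ∂halfLine := by
    rw [← integral_const_mul, ← integral_const_mul, ← integral_add (iA.const_mul _) iB]
    refine integral_mono (iC.const_mul _) ((iA.const_mul _).add iB) fun x => ?_
    have := mul_nonneg (Real.exp_pos (-(2 * M * x))).le (sq_nonneg (M * F x - F' x))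
    simp only
    nlinarith
  have h3 : M ^ 2 * ∫ x, Real.exp (-(2 * M * x)) * F x ^ 2 ∂halfLine =
      M * ∫ x, Real.exp (-(2 * M * x)) * F x * F' x ∂halfLine := by
    have : M * ∫ x, Real.exp (-(2 * M * x)) * F x ^ 2 ∂halfLine =
      ∫ x, Real.exp (-(2 * M * x)) * F x * F' x ∂halfLine := by linarith
    rw [← this]
    ring
  linarith

namespace IsAiryEigenfun

variable {c μ : ℝ} {F : ℝ → ℝ}

theorem eq_zero_of_ae_eq_zero (h : IsAiryEigenfun c μ F) (hμ : μ ≠ 0) (h0 : F =ᵐ[halfLine] 0) :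
    F = 0 := by
  funext x
  have h1 := h.eigen x
  rw [airyOp_congr h0] at h1
  simpa [airyOp, hμ] using h1

/-- Taking `G` to be the `n`-th derivative, the weighted norm is at least `(|c| + 1)^n` times that
of `F`, while the plain norm is at most `|c|^n` times that of `F`. The weight is at most `1`, so
letting `n` tend to infinity forces the weighted norm of `F` to vanish. -/
theorem eq_zero (h : IsAiryEigenfun c μ F) (hμ : μ ≠ 0) (h0 : F 0 = 0) : F = 0 := by
  have key (n : ℕ) : ∃ (ν : ℝ) (G : ℝ → ℝ), ν ≠ 0 ∧ IsAiryEigenfun c ν G ∧ G 0 = 0 ∧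
      (|c| + 1) ^ n * (∫ x, Real.exp (-(2 * √(|c| + 1) * x)) * F x ^ 2 ∂halfLine) ≤
        ∫ x, Real.exp (-(2 * √(|c| + 1) * x)) * G x ^ 2 ∂halfLine ∧
      ∫ x, G x ^ 2 ∂halfLine ≤ |c| ^ n * ∫ x, F x ^ 2 ∂halfLine := by
    induction n with
    | zero => exact ⟨μ, F, hμ, h, h0, by simp, by simp⟩
    | succ n ih =>
      obtain ⟨ν, G, hν, hG, hG0, h1, h2⟩ := ih
      refine ⟨-ν, deriv G, neg_ne_zero.2 hν, hG.deriv_of_zero hν hG0,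
        hG.deriv_zero_of_zero hν hG0, ?_, ?_⟩
      · have h3 := integral_exp_mul_sq_le (hG.expDecay hν) (hG.expDecay_deriv hν)
          (hG.hasDerivAt hν) hG0 (M := √(|c| + 1)) (by positivity)
        rw [Real.sq_sqrt (by positivity)] at h3
        refine le_trans ?_ h3
        rw [pow_succ', mul_assoc]
        gcongr
      · refine (hG.integral_deriv_sq_le hν hG0).trans ?_
        rw [pow_succ', mul_assoc]
        gcongr
  have hD := h.expDecay hμ
  have hcF := hD.cont
  have hw {G : ℝ → ℝ} (hG : ExpDecay G) :
      Integrable (fun x => Real.exp (-(2 * √(|c| + 1) * x)) * G x ^ 2) halfLine ∧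
      ∫ x, Real.exp (-(2 * √(|c| + 1) * x)) * G x ^ 2 ∂halfLine ≤ ∫ x, G x ^ 2 ∂halfLine := by
    have i2 : Integrable (fun x => G x ^ 2) halfLine := by
      simpa [pow_two] using hG.integrable_mul hG
    have hle : ∀ᵐ x ∂halfLine, Real.exp (-(2 * √(|c| + 1) * x)) * G x ^ 2 ≤ G x ^ 2 :=
      ae_halfLine_of_forall fun x hx => mul_le_of_le_one_left (sq_nonneg _)
        (Real.exp_le_one_iff.2 (by rw [neg_nonpos]; positivity))
    have hcG := hG.cont
    have i1 : Integrable (fun x => Real.exp (-(2 * √(|c| + 1) * x)) * G x ^ 2) halfLine := by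
      refine i2.mono' (Continuous.aestronglyMeasurable (by fun_prop)) ?_
      filter_upwards [hle] with x hx
      rwa [Real.norm_of_nonneg (by positivity)]
    exact ⟨i1, integral_mono_ae i1 i2 hle⟩
  set I := ∫ x, Real.exp (-(2 * √(|c| + 1) * x)) * F x ^ 2 ∂halfLine with hI
  have hI0 : 0 ≤ I := integral_nonneg fun x => by positivity
  have hle (n : ℕ) : I ≤ (|c| / (|c| + 1)) ^ n * ∫ x, F x ^ 2 ∂halfLine := by
    obtain ⟨ν, G, hν, hG, -, h1, h2⟩ := key n
    have h3 := h1.trans ((hw (hG.expDecay hν)).2.trans h2)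
    rw [div_pow, div_mul_eq_mul_div, le_div_iff₀ (by positivity), mul_comm I]
    exact h3
  have hlim : Tendsto (fun n : ℕ => (|c| / (|c| + 1)) ^ n * ∫ x, F x ^ 2 ∂halfLine) atTop
      (𝓝 (0 * ∫ x, F x ^ 2 ∂halfLine)) :=
    (tendsto_pow_atTop_nhds_zero_of_lt_one (by positivity)
      ((div_lt_one (by positivity)).2 (lt_add_one _))).mul_const _
  rw [zero_mul] at hlim
  have hI1 : I = 0 := le_antisymm (ge_of_tendsto' hlim hle) hI0
  refine h.eq_zero_of_ae_eq_zero hμ ?_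
  have := (integral_eq_zero_iff_of_nonneg (fun x => by simp only [Pi.zero_apply]; positivity)
    (hw hD).1).1 hI1
  filter_upwards [this] with x hx
  simpa [(Real.exp_pos _).ne'] using hx

theorem proportional {G : ℝ → ℝ} (hF : IsAiryEigenfun c μ F) (hG : IsAiryEigenfun c μ G)
    (hμ : μ ≠ 0) (x : ℝ) : F 0 * G x = G 0 * F x := by
  have h := ((hG.const_mul (F 0)).add (hF.const_mul (-G 0))).eq_zero hμ (by ring)
  have := congrFun h x
  simp only [Pi.zero_apply] at this
  linarith

theorem eq_zero_or_eq_zero_of_neg {G : ℝ → ℝ} (hF : IsAiryEigenfun c μ F)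
    (hG : IsAiryEigenfun c (-μ) G) (hμ : μ ≠ 0) : F = 0 ∨ G = 0 :=
  (mul_eq_zero.1 (hF.mul_zero_of_neg hG hμ)).imp (hF.eq_zero hμ) (hG.eq_zero (neg_ne_zero.2 hμ))

end IsAiryEigenfun

/-! ### Injectivity of the operator through a moment problem. -/

/-- The positive and negative parts of `h` are densities of finite measures with the same
characteristic function, hence agree almost everywhere. -/
theorem MeasureTheory.Integrable.ae_eq_zero_of_integral_char_eq_zero {ν : Measure ℝ}
    {h : ℝ → ℝ} (hh : Integrable h ν)
    (hz : ∀ t : ℝ, ∫ x, Complex.exp (t * x * Complex.I) * h x ∂ν = 0) : h =ᵐ[ν] 0 := by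
  have hm := hh.aestronglyMeasurable.aemeasurable
  have hmp : AEMeasurable (fun x => ENNReal.ofReal (h x)) ν := hm.ennreal_ofReal
  have hmn : AEMeasurable (fun x => ENNReal.ofReal (-h x)) ν := hm.neg.ennreal_ofReal
  have fp : IsFiniteMeasure (ν.withDensity fun x => ENNReal.ofReal (h x)) :=
    isFiniteMeasure_withDensity_ofReal hh.2
  have fn : IsFiniteMeasure (ν.withDensity fun x => ENNReal.ofReal (-h x)) :=
    isFiniteMeasure_withDensity_ofReal hh.neg.2
  have hint (t : ℝ) {g : ℝ → ℝ} (hg : Integrable g ν) :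
      Integrable (fun x : ℝ => (ENNReal.ofReal (g x)).toReal •
        Complex.exp (t * x * Complex.I)) ν := by
    have hc : Continuous fun x : ℝ => Complex.exp (t * x * Complex.I) := by fun_prop
    have hr : AEStronglyMeasurable (fun x => (ENNReal.ofReal (g x)).toReal) ν :=
      hg.aestronglyMeasurable.aemeasurable.ennreal_ofReal.ennreal_toReal.aestronglyMeasurable
    refine hg.norm.mono' (hr.smul hc.aestronglyMeasurable) (Eventually.of_forall fun x => ?_)
    rw [norm_smul, ← Complex.ofReal_mul, Complex.norm_exp_ofReal_mul_I, mul_one,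
      Real.norm_of_nonneg ENNReal.toReal_nonneg, ENNReal.toReal_ofReal']
    exact max_le (le_abs_self _) (abs_nonneg _)
  have heq : (ν.withDensity fun x => ENNReal.ofReal (h x)) =
      ν.withDensity fun x => ENNReal.ofReal (-h x) := by
    refine Measure.ext_of_charFun (funext fun t => ?_)
    rw [charFun_apply_real, charFun_apply_real,
      integral_withDensity_eq_integral_toReal_smul₀ hmp (by simp),
      integral_withDensity_eq_integral_toReal_smul₀ hmn (by simp), ← sub_eq_zero,
      ← integral_sub (hint t hh) (by simpa only [Pi.neg_apply] using hint t hh.neg), ← hz t]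
    refine integral_congr_ae (Eventually.of_forall fun x => ?_)
    simp only [← sub_smul, ENNReal.toReal_ofReal']
    rw [show max (h x) 0 - max (-h x) 0 = h x from max_zero_sub_max_neg_zero_eq_self (h x),
      Complex.real_smul, mul_comm]
  have h1 := (withDensity_eq_iff hmp hmn (by
    have := fp.measure_univ_lt_top
    rw [withDensity_apply _ MeasurableSet.univ, setLIntegral_univ] at this
    exact this.ne)).1 heq
  filter_upwards [h1] with x hx
  have h2 := congrArg ENNReal.toReal hx
  rw [ENNReal.toReal_ofReal', ENNReal.toReal_ofReal'] at h2
  have := max_zero_sub_max_neg_zero_eq_self (h x)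
  simp only [Pi.zero_apply]
  linarith

/-- A function with all exponential moments on the half-line is determined by its moments. -/
theorem ae_eq_zero_of_forall_moment_eq_zero {h : ℝ → ℝ}
    (hexp : ∀ r : ℝ, Integrable (fun y => Real.exp (r * y) * h y) halfLine)
    (hmom : ∀ k : ℕ, ∫ y, y ^ k * h y ∂halfLine = 0) : h =ᵐ[halfLine] 0 := by
  have hh : Integrable h halfLine := by simpa using hexp 0
  have hm := hh.aestronglyMeasurable
  refine hh.ae_eq_zero_of_integral_char_eq_zero fun t => ?_
  have hsum := hasSum_integral_of_dominated_convergence (μ := halfLine)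
    (F := fun (n : ℕ) (y : ℝ) => ((t * y * Complex.I) ^ n / (n.factorial : ℂ)) * (h y : ℂ))
    (f := fun y : ℝ => Complex.exp (t * y * Complex.I) * h y)
    (fun (n : ℕ) (y : ℝ) => (|t| * |y|) ^ n / n.factorial * |h y|)
    (fun n => (Continuous.aestronglyMeasurable (by fun_prop)).mul
      (Complex.continuous_ofReal.comp_aestronglyMeasurable hm)) ?_ ?_ ?_ ?_
  · refine hsum.unique ?_
    convert hasSum_zero with n
    have : ∀ y : ℝ, ((t * y * Complex.I) ^ n / (n.factorial : ℂ)) * (h y : ℂ) =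
        ((t * Complex.I) ^ n / (n.factorial : ℂ)) * ((y ^ n * h y : ℝ) : ℂ) := fun y => by
      push_cast
      ring
    simp only [this]
    rw [integral_const_mul, integral_complex_ofReal, hmom]
    simp
  · refine fun n => Eventually.of_forall fun y => ?_
    simp
  · exact Eventually.of_forall fun y => (Real.summable_pow_div_factorial _).mul_right _
  · refine (hexp |t|).norm.congr (ae_halfLine_of_forall fun y hy => ?_)
    simp only
    rw [tsum_mul_right, norm_mul, Real.norm_eq_abs, Real.abs_exp, Real.norm_eq_abs,
      Real.exp_eq_exp_ℝ, NormedSpace.exp_eq_tsum_div, abs_of_nonneg hy]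
  · refine Eventually.of_forall fun y => HasSum.mul_right _ ?_
    rw [Complex.exp_eq_exp_ℂ]
    exact NormedSpace.expSeries_div_hasSum_exp _

/-- Differentiating the vanishing identity twice in `s` and using `Ai'' (s + y) = (s + y) Ai (s +
y)` gains one power of `y`. -/
theorem integral_airyAi_pow_mul_eq_zero {f : ℝ → ℝ} (hf : MemLp f 2 halfLine) {c : ℝ}
    (h : ∀ s, c < s → ∫ y, airyAi (s + y) * f y ∂halfLine = 0) (k : ℕ) :
    ∀ s, c < s → ∫ y, airyAi (s + y) * (y ^ k * f y) ∂halfLine = 0 := by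
  induction k with
  | zero => simpa using h
  | succ k ih =>
    have i0 := hf.integrable_mul_pow_mul_exp_neg k
    have i1 := hf.integrable_mul_pow_mul_exp_neg (k + 1)
    simp only [pow_succ', mul_assoc _ (_ ^ k)] at i1
    have h1 : ∀ s, c < s → ∫ y, deriv airyAi (s + y) * (y ^ k * f y) ∂halfLine = 0 := by
      intro s hs
      refine (hasDerivAt_integral_airyAi i0 i1 s).unique
        ((hasDerivAt_const s (0 : ℝ)).congr_of_eventuallyEq ?_)
      filter_upwards [lt_mem_nhds hs] with x hx using ih x hx
    intro s hs
    have h2 := (hasDerivAt_integral_deriv_airyAi i0 i1 s).unique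
      ((hasDerivAt_const s (0 : ℝ)).congr_of_eventuallyEq
        (by filter_upwards [lt_mem_nhds hs] with x hx using h1 x hx))
    rw [ih s hs, mul_zero, zero_add] at h2
    simpa only [pow_succ', mul_assoc _ (_ ^ k)] using h2

/-- The Airy operator is injective. -/
theorem ae_eq_zero_of_airyOp_eq_zero {f : ℝ → ℝ} (hf : MemLp f 2 halfLine) {c : ℝ}
    (h : ∀ x, 0 < x → airyOp c f x = 0) : f =ᵐ[halfLine] 0 := by
  obtain ⟨X, hX⟩ := exists_forall_ge_airyAi_ne_zero
  -- Beyond `c` the moments vanish; beyond `X` the factor `Ai (s + y)` has no zero and can be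
  -- divided out.
  set s := max (c + 1) X
  have hs : c < s := (lt_add_one c).trans_le (le_max_left _ _)
  have hmom := fun k => integral_airyAi_pow_mul_eq_zero hf (c := c) (fun s hs => by
    have := h (s - c) (by linarith)
    rw [airyOp_eq] at this
    simpa using this) k s hs
  have hz : (fun y => airyAi (s + y) * f y) =ᵐ[halfLine] 0 := by
    refine ae_eq_zero_of_forall_moment_eq_zero (fun r => ?_) (fun k => ?_)
    -- Rate `|r| + 1` absorbs `exp (r y)` and leaves `exp (-y)` to integrate against `f`.
    · obtain ⟨C, hC0, hC⟩ := exists_abs_airyAi_le (η := |r| + 1) (by positivity)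
      have hi := hf.integrable_mul_exp_neg
      refine (hi.norm.const_mul (C * Real.exp (-((|r| + 1) * s)))).mono'
        ((Continuous.aestronglyMeasurable (by fun_prop)).mul
          ((Continuous.aestronglyMeasurable (by fun_prop)).mul hf.1)) ?_
      refine ae_halfLine_of_forall fun y hy => ?_
      simp only [norm_mul, Real.norm_eq_abs, Real.abs_exp]
      have h1 : Real.exp (r * y) * Real.exp (-((|r| + 1) * (s + y))) ≤
          Real.exp (-((|r| + 1) * s)) * Real.exp (-y) := by
        rw [← Real.exp_add, ← Real.exp_add]
        refine Real.exp_le_exp.2 ?_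
        have := mul_le_mul_of_nonneg_right (le_abs_self r) hy
        linarith
      calc Real.exp (r * y) * (|airyAi (s + y)| * |f y|)
          ≤ Real.exp (r * y) * (C * Real.exp (-((|r| + 1) * (s + y))) * |f y|) := by
            gcongr
            exact hC _
        _ = C * |f y| * (Real.exp (r * y) * Real.exp (-((|r| + 1) * (s + y)))) := by ring
        _ ≤ C * |f y| * (Real.exp (-((|r| + 1) * s)) * Real.exp (-y)) := by gcongr
        _ = _ := by ring
    · rw [← hmom k]
      congr 1 with y
      ring
  filter_upwards [hz, ae_halfLine_of_forall fun y hy => hy] with y hy hy0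
  exact (mul_eq_zero.1 hy).resolve_left (hX _ ((le_max_right _ _).trans (by linarith)))

/-! ### The Airy operator on `L²[0, ∞)`: compact, symmetric, locally Lipschitz in `c`. -/

noncomputable section

/-- The Hilbert–Schmidt operator `f ↦ (x ↦ ⟪f, k x⟫)` attached to a square-integrable family `k`
of vectors, as a continuous function of `k`. -/
def hilbertSchmidt {α : Type*} [MeasurableSpace α] (ν : Measure α) (H : Type*)
    [NormedAddCommGroup H] [InnerProductSpace ℝ H] : Lp H 2 ν →L[ℝ] H →L[ℝ] Lp ℝ 2 ν :=
  (ContinuousLinearMap.compLpL₂ 2 ν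
    (isBoundedBilinearMap_inner (𝕜 := ℝ) (E := H)).toContinuousLinearMap).flip

section HilbertSchmidt

variable {α : Type*} [MeasurableSpace α] {ν : Measure α} {H : Type*}
    [NormedAddCommGroup H] [InnerProductSpace ℝ H]

theorem coeFn_hilbertSchmidt (k : Lp H 2 ν) (f : H) :
    hilbertSchmidt ν H k f =ᵐ[ν] fun x => ⟪f, k x⟫ :=
  ((isBoundedBilinearMap_inner (𝕜 := ℝ) (E := H)).toContinuousLinearMap f).coeFn_compLp' k

/-- An indicator family gives a rank-one operator; sums of compact operators are compact, and
compactness is a closed condition, which reaches every `k` by density and continuity. -/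
theorem isCompactOperator_hilbertSchmidt (k : Lp H 2 ν) :
    IsCompactOperator (hilbertSchmidt ν H k) := by
  refine Lp.induction (p := 2) (by simp)
    (motive := fun k => IsCompactOperator (hilbertSchmidt ν H k)) ?_ ?_ ?_ k
  · intro c s hs hμs
    rw [Lp.simpleFunc.coe_indicatorConst]
    set v : Lp ℝ 2 ν := indicatorConstLp 2 hs hμs.ne 1
    have h : hilbertSchmidt ν H (indicatorConstLp 2 hs hμs.ne c) =
        (ContinuousLinearMap.toSpanSingleton ℝ v) ∘L (innerSL ℝ c) := by
      ext1 f
      refine Lp.ext ?_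
      filter_upwards [coeFn_hilbertSchmidt (indicatorConstLp 2 hs hμs.ne c) f,
        indicatorConstLp_coeFn (p := 2) (hs := hs) (hμs := hμs.ne) (c := c),
        indicatorConstLp_coeFn (p := 2) (hs := hs) (hμs := hμs.ne) (c := (1 : ℝ)),
        Lp.coeFn_smul ⟪c, f⟫ v] with x h1 h2 h3 h4
      rw [h1, h2]
      simp only [ContinuousLinearMap.comp_apply, ContinuousLinearMap.toSpanSingleton_apply,
        innerSL_apply_apply]
      rw [h4, Pi.smul_apply, h3, real_inner_comm]
      by_cases hx : x ∈ s
      · rw [Set.indicator_of_mem hx, Set.indicator_of_mem hx]; simp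
      · rw [Set.indicator_of_notMem hx, Set.indicator_of_notMem hx]; simp
    rw [h]
    exact (isCompactOperator_of_locallyCompactSpace_dom (innerSL ℝ c)).clm_comp
      (ContinuousLinearMap.toSpanSingleton ℝ v)
  · intro f g hf hg _ hf' hg'
    rw [map_add]
    exact hf'.add hg'
  · exact (isClosed_setOfPred_isCompactOperator).preimage (hilbertSchmidt ν H).continuous

end HilbertSchmidt

/-- The Hilbert space `L²[0, ∞)`. -/
abbrev HalfLineL2 : Type := Lp ℝ 2 halfLine

/-- The translates of the Airy function as a curve in `L²[0, ∞)`. -/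
def airyCurve (s : ℝ) : HalfLineL2 := (expDecay_airyAi_shift s).memLp.toLp _

/-- The function `exp (-x)` as an element of `L²[0, ∞)`. -/
def expL2 : HalfLineL2 := expDecay_exp.memLp.toLp _

theorem coeFn_expL2 : expL2 =ᵐ[halfLine] fun x => Real.exp (-x) := MemLp.coeFn_toLp _

theorem coeFn_airyCurve (s : ℝ) : airyCurve s =ᵐ[halfLine] fun y => airyAi (s + y) :=
  MemLp.coeFn_toLp _

theorem abs_airyAi_sub_le {C : ℝ} (hC0 : 0 ≤ C) (hC : ∀ x, |deriv airyAi x| ≤ C * Real.exp (-x))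
    (x y : ℝ) : |airyAi x - airyAi y| ≤ C * Real.exp |x - y| * Real.exp (-y) * |x - y| := by
  refine (convex_uIcc x y).norm_image_sub_le_of_norm_hasDerivWithin_le (f := airyAi)
    (fun z _ => (hasDerivAt_airyAi z).hasDerivWithinAt) (fun z hz => ?_)
    Set.right_mem_uIcc Set.left_mem_uIcc
  refine (hC z).trans ?_
  rw [mul_assoc, ← Real.exp_add]
  refine mul_le_mul_of_nonneg_left (Real.exp_le_exp.2 ?_) hC0
  rcases Set.mem_uIcc.1 hz with h | h
  · linarith [neg_abs_le (x - y), h.1]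
  · linarith [h.1, abs_nonneg (x - y)]

theorem exists_norm_airyCurve_bound : ∃ C, 0 ≤ C ∧ (∀ s, ‖airyCurve s‖ ≤ C * Real.exp (-s)) ∧
    ∀ s t, ‖airyCurve s - airyCurve t‖ ≤ C * Real.exp |s - t| * Real.exp (-t) * |s - t| := by
  obtain ⟨C, hC0, hC⟩ := exists_airyAi_deriv_bound
  refine ⟨C * ‖expL2‖, by positivity, fun s => ?_, fun s t => ?_⟩
  · have h : ‖airyCurve s‖ ≤ (C * Real.exp (-s)) * ‖expL2‖ := by
      refine Lp.norm_le_mul_norm_of_ae_le_mul ?_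
      filter_upwards [coeFn_expL2, coeFn_airyCurve s] with y h1 h2
      rw [h1, h2, Real.norm_eq_abs, Real.norm_eq_abs, Real.abs_exp]
      refine ((hC _).1).trans_eq ?_
      rw [neg_add, Real.exp_add, mul_assoc]
    refine h.trans_eq ?_
    ring
  · have h : ‖airyCurve s - airyCurve t‖ ≤
        (C * Real.exp |s - t| * Real.exp (-t) * |s - t|) * ‖expL2‖ := by
      refine Lp.norm_le_mul_norm_of_ae_le_mul ?_
      filter_upwards [coeFn_expL2, coeFn_airyCurve s, coeFn_airyCurve t,
        Lp.coeFn_sub (airyCurve s) (airyCurve t)] with y h1 h2 h3 h4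
      rw [h4, h1, Pi.sub_apply, h2, h3, Real.norm_eq_abs, Real.norm_eq_abs, Real.abs_exp]
      refine (abs_airyAi_sub_le hC0.le (fun x => (hC x).2) _ _).trans_eq ?_
      rw [add_sub_add_right_eq_sub, neg_add, Real.exp_add]
      ring
    refine h.trans_eq ?_
    ring

theorem continuous_airyCurve : Continuous airyCurve := by
  obtain ⟨C, hC0, -, hC⟩ := exists_norm_airyCurve_bound
  refine continuous_iff_continuousAt.2 fun t => ?_
  refine tendsto_iff_norm_sub_tendsto_zero.2 (squeeze_zero (fun _ => norm_nonneg _)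
    (fun s => hC s t) ?_)
  have : Continuous fun s : ℝ => C * Real.exp |s - t| * Real.exp (-t) * |s - t| := by fun_prop
  simpa using this.tendsto t

theorem memLp_airyCurve (c : ℝ) : MemLp (fun x => airyCurve (x + c)) 2 halfLine := by
  obtain ⟨C, hC0, hC, -⟩ := exists_norm_airyCurve_bound
  refine MemLp.of_le (expDecay_exp.const_mul (C * Real.exp (-c))).memLp
    (continuous_airyCurve.comp (by fun_prop)).aestronglyMeasurable
    (Eventually.of_forall fun x => (hC _).trans ?_)
  rw [Real.norm_of_nonneg (by positivity), neg_add, Real.exp_add]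
  exact le_of_eq (by ring)

/-- The Airy operator on `L²[0, ∞)`. -/
def airyL (c : ℝ) : HalfLineL2 →L[ℝ] HalfLineL2 :=
  hilbertSchmidt halfLine HalfLineL2 ((memLp_airyCurve c).toLp _)

theorem isCompactOperator_airyL (c : ℝ) : IsCompactOperator (airyL c) :=
  isCompactOperator_hilbertSchmidt _

theorem inner_eq_integral (f g : HalfLineL2) : ⟪f, g⟫ = ∫ x, f x * g x ∂halfLine := by
  rw [L2.inner_def]
  congr 1 with x
  simp [mul_comm]

theorem coeFn_airyL (c : ℝ) (f : HalfLineL2) : airyL c f =ᵐ[halfLine] airyOp c f := by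
  filter_upwards [coeFn_hilbertSchmidt ((memLp_airyCurve c).toLp _) f,
    (memLp_airyCurve c).coeFn_toLp] with x h1 h2
  rw [airyL, h1, h2, inner_eq_integral, airyOp_eq]
  refine integral_congr_ae ?_
  filter_upwards [coeFn_airyCurve (x + c)] with y hy
  rw [hy, mul_comm]

theorem airyL_isSymmetric (c : ℝ) : (airyL c).IsSymmetric := by
  intro f g
  simp only [ContinuousLinearMap.coe_coe]
  rw [inner_eq_integral, inner_eq_integral]
  have h1 : ∫ x, airyL c f x * g x ∂halfLine = ∫ x, airyOp c f x * g x ∂halfLine :=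
    integral_congr_ae ((coeFn_airyL c f).mono fun x hx => by simp only [hx])
  have h2 : ∫ x, f x * airyL c g x ∂halfLine = ∫ x, f x * airyOp c g x ∂halfLine :=
    integral_congr_ae ((coeFn_airyL c g).mono fun x hx => by simp only [hx])
  rw [h1, h2]
  exact integral_airyOp_mul c (Lp.memLp f).integrable_mul_exp_neg
    (Lp.memLp g).integrable_mul_exp_neg

/-- The Airy operators form a locally Lipschitz curve of operators. -/
theorem exists_norm_airyL_sub_le (c : ℝ) :
    ∃ K, 0 ≤ K ∧ ∀ c', |c' - c| ≤ 1 → ‖airyL c' - airyL c‖ ≤ K * |c' - c| := by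
  obtain ⟨C, hC0, -, hC⟩ := exists_norm_airyCurve_bound
  refine ⟨‖hilbertSchmidt halfLine HalfLineL2‖ * (C * Real.exp 1 * Real.exp (-c) * ‖expL2‖),
    by positivity, fun c' hc' => ?_⟩
  rw [airyL, airyL, ← map_sub]
  refine (ContinuousLinearMap.le_opNorm _ _).trans ?_
  rw [mul_assoc]
  refine mul_le_mul_of_nonneg_left ?_ (norm_nonneg _)
  have h : ‖(memLp_airyCurve c').toLp _ - (memLp_airyCurve c).toLp _‖ ≤
      (C * Real.exp 1 * Real.exp (-c) * |c' - c|) * ‖expL2‖ := by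
    refine Lp.norm_le_mul_norm_of_ae_le_mul ?_
    filter_upwards [coeFn_expL2, (memLp_airyCurve c').coeFn_toLp, (memLp_airyCurve c).coeFn_toLp,
      Lp.coeFn_sub ((memLp_airyCurve c').toLp _) ((memLp_airyCurve c).toLp _)] with x h1 h2 h3 h4
    rw [h4, h1, Pi.sub_apply, h2, h3, Real.norm_eq_abs, Real.abs_exp]
    refine (hC _ _).trans ?_
    rw [add_sub_add_left_eq_sub, neg_add, Real.exp_add]
    calc C * Real.exp |c' - c| * (Real.exp (-x) * Real.exp (-c)) * |c' - c|
        ≤ C * Real.exp 1 * (Real.exp (-x) * Real.exp (-c)) * |c' - c| := by gcongr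
      _ = _ := by ring
  refine h.trans_eq ?_
  ring

end

/-! ### Perturbation of eigenvalues ordered by modulus. -/

section Perturbation

variable {H : Type*} [NormedAddCommGroup H] [InnerProductSpace ℝ H]

theorem HilbertBasis.hasSum_inner_sq {ι : Type*} (b : HilbertBasis ι ℝ H) (x : H) :
    HasSum (fun i => ⟪b i, x⟫ ^ 2) (‖x‖ ^ 2) := by
  rw [← real_inner_self_eq_norm_sq]
  refine (b.hasSum_inner_mul_inner x x).congr_fun fun i => ?_
  rw [real_inner_comm x, pow_two]

theorem inner_apply_of_eigenvector {A : H →L[ℝ] H} (hA : A.IsSymmetric) {e : H} {μ : ℝ}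
    (he : A e = μ • e) (x : H) : ⟪e, A x⟫ = μ * ⟪e, x⟫ := by
  have := hA e x
  simp only [ContinuousLinearMap.coe_coe] at this
  rw [← this, he, real_inner_smul_left]

variable {A B : H →L[ℝ] H} {a b : HilbertBasis ℕ ℝ H} {l m : ℕ → ℝ}

theorem norm_apply_le_of_inner_eq_zero (hA : A.IsSymmetric) (ha : ∀ i, A (a i) = l i • a i)
    (hl : Antitone fun i => |l i|) {n : ℕ} {x : H} (hx : ∀ i < n, ⟪a i, x⟫ = 0) :
    ‖A x‖ ≤ |l n| * ‖x‖ := by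
  refine abs_le_of_sq_le_sq' ?_ (by positivity) |>.2
  rw [mul_pow]
  refine hasSum_le (fun i => ?_) (a.hasSum_inner_sq (A x)) ((a.hasSum_inner_sq x).mul_left _)
  rw [inner_apply_of_eigenvector hA (ha i), mul_pow]
  rcases lt_or_ge i n with h | h
  · rw [hx i h]; simp
  · rw [← sq_abs (l i)]
    have := hl h
    gcongr

theorem le_norm_apply_of_inner_eq_zero (hA : A.IsSymmetric) (ha : ∀ i, A (a i) = l i • a i)
    (hl : Antitone fun i => |l i|) {n : ℕ} {x : H} (hx : ∀ i, n < i → ⟪a i, x⟫ = 0) :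
    |l n| * ‖x‖ ≤ ‖A x‖ := by
  refine abs_le_of_sq_le_sq' ?_ (by positivity) |>.2
  rw [mul_pow]
  refine hasSum_le (fun i => ?_) ((a.hasSum_inner_sq x).mul_left _) (a.hasSum_inner_sq (A x))
  rw [inner_apply_of_eigenvector hA (ha i), mul_pow]
  rcases lt_or_ge n i with h | h
  · rw [hx i h]; simp
  · rw [← sq_abs (l i)]
    have := hl h
    gcongr

/-- Dimension count: `n` linear conditions on the span of `a 0, …, a n`. This is the test vector of
the min-max argument. -/
theorem exists_ne_zero_inner_eq_zero (a b : HilbertBasis ℕ ℝ H) (n : ℕ) :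
    ∃ x : H, x ≠ 0 ∧ (∀ i, n < i → ⟪a i, x⟫ = 0) ∧ ∀ i < n, ⟪b i, x⟫ = 0 := by
  let S : (Fin (n + 1) → ℝ) →ₗ[ℝ] H :=
    Fintype.linearCombination ℝ (fun i : Fin (n + 1) => a i)
  let T : H →ₗ[ℝ] (Fin n → ℝ) := LinearMap.pi fun i => (innerSL ℝ (b i) : H →ₗ[ℝ] ℝ)
  have hker : LinearMap.ker (T ∘ₗ S) ≠ ⊥ := LinearMap.ker_ne_bot_of_finrank_lt (by simp)
  obtain ⟨v, hv, hv0⟩ := Submodule.exists_mem_ne_zero_of_ne_bot hker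
  have hS : S v = ∑ i : Fin (n + 1), v i • a i := Fintype.linearCombination_apply ..
  have hin (k : ℕ) : ⟪a k, S v⟫ = ∑ i : Fin (n + 1), v i * if k = i then 1 else 0 := by
    rw [hS, inner_sum]
    refine Finset.sum_congr rfl fun i _ => ?_
    rw [real_inner_smul_right, orthonormal_iff_ite.1 a.orthonormal]
  refine ⟨S v, fun h0 => hv0 (funext fun i => ?_), fun i hi => ?_, fun i hi => ?_⟩
  · have := hin i
    rw [h0, inner_zero_right] at this
    simpa [Fin.val_inj] using this.symm
  · rw [hin]
    refine Finset.sum_eq_zero fun j _ => ?_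
    rw [if_neg (by omega), mul_zero]
  · exact congrFun (LinearMap.mem_ker.1 hv) ⟨i, hi⟩

/-- Weyl's inequality for the moduli of the eigenvalues. -/
theorem abs_eigenvalue_le_add_norm_sub (hA : A.IsSymmetric) (hB : B.IsSymmetric)
    (ha : ∀ i, A (a i) = l i • a i) (hb : ∀ i, B (b i) = m i • b i)
    (hl : Antitone fun i => |l i|) (hm : Antitone fun i => |m i|) (n : ℕ) :
    |l n| ≤ |m n| + ‖B - A‖ := by
  obtain ⟨x, hx0, hxa, hxb⟩ := exists_ne_zero_inner_eq_zero a b n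
  have hx : 0 < ‖x‖ := norm_pos_iff.2 hx0
  have h1 := le_norm_apply_of_inner_eq_zero hA ha hl hxa
  have h2 := norm_apply_le_of_inner_eq_zero hB hb hm hxb
  have h3 := (B - A).le_opNorm x
  have h4 : ‖A x‖ ≤ ‖B x‖ + ‖(B - A) x‖ := by
    have := norm_sub_le (B x) ((B - A) x)
    rwa [sub_apply, sub_sub_cancel] at this
  refine le_of_mul_le_mul_right ?_ hx
  rw [add_mul]
  linarith

/-- Second-order remainder estimate for first-order perturbation of a simple eigenvalue. -/
theorem abs_eigenvalue_sub_sub_inner_le (hA : A.IsSymmetric) (hB : B.IsSymmetric)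
    (ha : ∀ i, A (a i) = l i • a i) (hb : ∀ i, B (b i) = m i • b i)
    (hl : Antitone fun i => |l i|) (hm : Antitone fun i => |m i|) (n : ℕ) {δ : ℝ} (hδ : 0 < δ)
    (hgap : ∀ k, k ≠ n → δ ≤ |(|l k| - |l n|)|) (hBA : 4 * ‖B - A‖ ≤ δ) :
    |m n - l n - ⟪(B - A) (a n), a n⟫| ≤ 4 / δ * ‖B - A‖ ^ 2 := by
  set ε := ‖B - A‖ with hε
  have hε0 : 0 ≤ ε := norm_nonneg _
  have hna : ‖a n‖ = 1 := a.orthonormal.1 n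
  have hnb : ‖b n‖ = 1 := b.orthonormal.1 n
  set α := ⟪a n, b n⟫ with hα
  have hw1 : |l n| ≤ |m n| + ε := abs_eigenvalue_le_add_norm_sub hA hB ha hb hl hm n
  have hw2 : |m n| ≤ |l n| + ε := by
    have := abs_eigenvalue_le_add_norm_sub hB hA hb ha hm hl n
    rwa [norm_sub_rev] at this
  -- `r` is the part of `b n` orthogonal to `a n`. Its coefficients satisfy `(m n - l k) ⟪a k, b n⟫
  -- = ⟪a k, (B - A) (b n)⟫`, so the gap controls `‖r‖`.
  set r := b n - α • a n with hr
  have hrsum := a.hasSum_inner_sq r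
  have hbsum := (a.hasSum_inner_sq ((B - A) (b n))).mul_left ((2 / δ) ^ 2)
  have hAB : (B - A) (b n) = m n • b n - A (b n) := by
    rw [sub_apply, hb]
  have hrle : ‖r‖ ^ 2 ≤ (2 / δ) ^ 2 * ‖(B - A) (b n)‖ ^ 2 := by
    refine hasSum_le (fun k => ?_) hrsum hbsum
    rw [← mul_pow, hAB, hr, inner_sub_right, inner_sub_right, real_inner_smul_right,
      real_inner_smul_right, inner_apply_of_eigenvector hA (ha k),
      orthonormal_iff_ite.1 a.orthonormal]
    by_cases hk : k = n
    · subst hk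
      simp only [if_true, mul_one, ← hα, sub_self]
      rw [zero_pow two_ne_zero]
      positivity
    · rw [if_neg hk, mul_zero, sub_zero, ← sub_mul, ← mul_assoc, mul_pow]
      refine le_mul_of_one_le_left (sq_nonneg _) (one_le_sq_iff_one_le_abs _ |>.2 ?_)
      -- Weyl moves `|l n|` to `|m n|` at a cost of at most `ε ≤ δ / 4`, leaving more than half of
      -- the gap.
      have h1 : δ / 2 ≤ |m n - l k| := by
        have h2 := hgap k hk
        have h3 := abs_abs_sub_abs_le_abs_sub (m n) (l k)
        have h4 : |(|l k| - |l n|)| ≤ |(|m n| - |l k|)| + ε := by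
          rw [abs_le]
          constructor
          · linarith [le_abs_self (|m n| - |l k|)]
          · linarith [neg_abs_le (|m n| - |l k|)]
        linarith
      rw [abs_mul, abs_of_pos (by positivity : 0 < 2 / δ), div_mul_eq_mul_div, le_div_iff₀ hδ]
      linarith
  have hAbn : ‖(B - A) (b n)‖ ≤ ε := by simpa [hnb] using (B - A).le_opNorm (b n)
  have hrn : ‖r‖ ≤ 2 / δ * ε := by
    refine abs_le_of_sq_le_sq' ?_ (by positivity) |>.2
    rw [mul_pow]
    refine hrle.trans ?_
    gcongr
  have hrhalf : ‖r‖ ≤ 1 / 2 := by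
    refine hrn.trans ?_
    rw [div_mul_eq_mul_div, div_le_iff₀ hδ]
    linarith
  -- Only `|α|` is bounded below, so the sign of `b n` plays no role.
  have hαhalf : 1 / 2 ≤ |α| := by
    have h1 : ‖b n‖ ≤ ‖r‖ + ‖α • a n‖ := by
      have := norm_add_le r (α • a n)
      rwa [hr, sub_add_cancel] at this
    rw [hnb, norm_smul, hna, mul_one, Real.norm_eq_abs] at h1
    linarith
  have hkey : (m n - l n) * α = α * ⟪(B - A) (a n), a n⟫ + ⟪(B - A) (a n), r⟫ := by
    have h1 : ⟪(B - A) (a n), b n⟫ = (m n - l n) * α := by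
      have h2 := hB (a n) (b n)
      simp only [ContinuousLinearMap.coe_coe] at h2
      rw [sub_apply, inner_sub_left, h2, hb, ha, real_inner_smul_left,
        real_inner_smul_right]
      ring
    rw [← h1, hr, inner_sub_right, real_inner_smul_right]
    ring
  -- The error times `α` equals `⟪(B - A) (a n), r⟫`, a product of two first-order quantities.
  have hrem : |(m n - l n - ⟪(B - A) (a n), a n⟫) * α| ≤ ε * (2 / δ * ε) := by
    have h1 : (m n - l n - ⟪(B - A) (a n), a n⟫) * α = ⟪(B - A) (a n), r⟫ := by
      linear_combination hkey
    rw [h1]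
    refine (abs_real_inner_le_norm _ _).trans ?_
    have : ‖(B - A) (a n)‖ ≤ ε := by simpa [hna] using (B - A).le_opNorm (a n)
    gcongr
  rw [abs_mul] at hrem
  have h5 : |m n - l n - ⟪(B - A) (a n), a n⟫| * (1 / 2) ≤ ε * (2 / δ * ε) :=
    (mul_le_mul_of_nonneg_left hαhalf (abs_nonneg _)).trans hrem
  calc |m n - l n - ⟪(B - A) (a n), a n⟫| ≤ 2 * (ε * (2 / δ * ε)) := by linarith
    _ = _ := by ring

theorem StrictAnti.exists_gap {s : ℕ → ℝ} (hs : StrictAnti s) (n : ℕ) :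
    ∃ δ, 0 < δ ∧ ∀ k, k ≠ n → δ ≤ |s k - s n| := by
  have hup : ∃ δ, 0 < δ ∧ ∀ k, k < n → δ ≤ s k - s n := by
    rcases n with _ | n
    · exact ⟨1, one_pos, fun k hk => absurd hk (Nat.not_lt_zero k)⟩
    · refine ⟨s n - s (n + 1), sub_pos.2 (hs n.lt_succ_self), fun k hk => ?_⟩
      linarith [hs.antitone (Nat.le_of_lt_succ hk)]
  obtain ⟨δ, hδ, h⟩ := hup
  refine ⟨min δ (s n - s (n + 1)), lt_min hδ (sub_pos.2 (hs n.lt_succ_self)), fun k hk => ?_⟩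
  rcases lt_or_gt_of_ne hk with hk | hk
  · exact (min_le_left _ _).trans ((h k hk).trans (le_abs_self _))
  · refine (min_le_right _ _).trans ?_
    rw [abs_sub_comm]
    exact le_trans (by linarith [hs.antitone (Nat.succ_le_of_lt hk)]) (le_abs_self _)

theorem hasDerivAt_zero_of_abs_le_sq {f : ℝ → ℝ} {c M : ℝ}
    (h : ∀ᶠ t in 𝓝 c, |f t| ≤ M * (t - c) ^ 2) : HasDerivAt f 0 c := by
  have h0 : f c = 0 := by simpa using h.self_of_nhds
  rw [hasDerivAt_iff_isLittleO]
  simp only [h0, sub_zero, smul_zero]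
  have h1 : f =O[𝓝 c] fun t => (t - c) ^ 2 :=
    Asymptotics.IsBigO.of_bound M (h.mono fun t ht => by simpa using ht)
  refine h1.trans_isLittleO ?_
  have h2 : (fun t : ℝ => (t - c) * (t - c)) =o[𝓝 c] fun t => (t - c) * 1 := by
    refine (Asymptotics.isBigO_refl _ _).mul_isLittleO ((Asymptotics.isLittleO_one_iff ℝ).2 ?_)
    have : Continuous fun t : ℝ => t - c := by fun_prop
    simpa using this.tendsto c
  simpa [pow_two] using h2

/-- The Hellmann–Feynman formula for simple eigenvalues of a Lipschitz family of symmetric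
operators with eigenbases ordered by modulus. -/
theorem hasDerivAt_eigenvalue {A : ℝ → H →L[ℝ] H} {b : ℝ → HilbertBasis ℕ ℝ H}
    {l : ℝ → ℕ → ℝ} (hA : ∀ t, (A t).IsSymmetric) (hb : ∀ t i, A t (b t i) = l t i • b t i)
    (hl : ∀ t, StrictAnti fun i => |l t i|) {c K d : ℝ}
    (hK : ∀ t, |t - c| ≤ 1 → ‖A t - A c‖ ≤ K * |t - c|) (n : ℕ)
    (hd : HasDerivAt (fun t => ⟪A t (b c n), b c n⟫) d c) :
    HasDerivAt (fun t => l t n) d c := by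
  obtain ⟨δ, hδ, hgap⟩ := (hl c).exists_gap n
  have hsmall : ∀ᶠ t in 𝓝 c, |t - c| ≤ 1 ∧ 4 * (K * |t - c|) ≤ δ := by
    have h1 : Continuous fun t : ℝ => |t - c| := by fun_prop
    have h2 : Continuous fun t : ℝ => 4 * (K * |t - c|) := by fun_prop
    exact (h1.tendsto' c 0 (by simp) |>.eventually (ge_mem_nhds one_pos)).and
      (h2.tendsto' c 0 (by simp) |>.eventually (ge_mem_nhds hδ))
  have hrem : HasDerivAt (fun t => l t n - l c n - ⟪(A t - A c) (b c n), b c n⟫) 0 c := by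
    refine hasDerivAt_zero_of_abs_le_sq (M := 4 / δ * K ^ 2) ?_
    filter_upwards [hsmall] with t ht
    have hle := hK t ht.1
    refine (abs_eigenvalue_sub_sub_inner_le (hA c) (hA t) (hb c) (hb t) (hl c).antitone
      (hl t).antitone n hδ hgap (by linarith [ht.2])).trans ?_
    calc 4 / δ * ‖A t - A c‖ ^ 2 ≤ 4 / δ * (K * |t - c|) ^ 2 := by gcongr
      _ = _ := by rw [mul_pow, sq_abs]; ring
  have h := ((hrem.add hd).add_const (l c n)).sub_const ⟪A c (b c n), b c n⟫
  rw [zero_add] at h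
  refine h.congr_of_eventuallyEq (Eventually.of_forall fun t => ?_)
  simp only [sub_apply, inner_sub_left, Pi.add_apply]
  ring

end Perturbation

/-! ### Enumerating the spectrum of a compact symmetric operator with simple moduli. -/

/-- Counting the elements above `s` embeds `S` into `ℕ` with reversed order, and an infinite subset
of `ℕ` is order isomorphic to `ℕ`. -/
theorem exists_strictAnti_range_eq {S : Set ℝ} (hfin : ∀ s ∈ S, (S ∩ Set.Ioi s).Finite)
    (hinf : S.Infinite) : ∃ f : ℕ → ℝ, StrictAnti f ∧ Set.range f = S := by
  set φ : ℝ → ℕ := fun s => (S ∩ Set.Ioi s).ncard with hφ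
  have hanti : ∀ s ∈ S, ∀ t ∈ S, s < t → φ t < φ s := by
    intro s hs t ht hst
    refine Set.ncard_lt_ncard ⟨fun x hx => ⟨hx.1, hst.trans hx.2⟩, fun h => ?_⟩ (hfin s hs)
    exact lt_irrefl t (h ⟨ht, hst⟩).2
  have hinj : Set.InjOn φ S := by
    intro s hs t ht hst
    rcases lt_trichotomy s t with h | h | h
    · exact absurd hst (hanti s hs t ht h).ne'
    · exact h
    · exact absurd hst (hanti t ht s hs h).ne
  have : Infinite (φ '' S) := (hinf.image hinj).to_subtype
  let e := Nat.Subtype.orderIsoOfNat (φ '' S)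
  choose f hfS hfe using fun n => (e n).2
  refine ⟨f, fun n m hnm => ?_, Set.Subset.antisymm (Set.range_subset_iff.2 hfS) fun s hs => ?_⟩
  · have h1 : φ (f n) < φ (f m) := by
      rw [hfe, hfe]
      exact e.strictMono hnm
    by_contra! h
    rcases h.lt_or_eq with h | h
    · exact lt_asymm h1 (hanti _ (hfS n) _ (hfS m) h)
    · rw [h] at h1
      exact lt_irrefl _ h1
  · obtain ⟨n, hn⟩ := e.surjective ⟨φ s, s, hs, rfl⟩
    refine ⟨n, hinj (hfS n) hs ?_⟩
    rw [hfe, hn]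

section Spectral

variable {H : Type*} [NormedAddCommGroup H] [InnerProductSpace ℝ H]
  {A : H →L[ℝ] H}

theorem inner_eq_zero_of_eigenvalue_ne (hA : A.IsSymmetric) {μ ν : ℝ} {v w : H}
    (hv : A v = μ • v) (hw : A w = ν • w) (h : μ ≠ ν) : ⟪v, w⟫ = 0 := by
  have h1 := inner_apply_of_eigenvector hA hv w
  rw [hw, real_inner_smul_right] at h1
  have h2 : (μ - ν) * ⟪v, w⟫ = 0 := by linarith
  exact (mul_eq_zero.1 h2).resolve_left (sub_ne_zero.2 h)

/-- The moduli of the eigenvalues of an operator. -/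
def eigenvalueModuli (A : H →L[ℝ] H) : Set ℝ :=
  {s | ∃ (μ : ℝ) (v : H), ‖v‖ = 1 ∧ A v = μ • v ∧ |μ| = s}

/-- Eigenvectors whose eigenvalues have the same modulus are proportional. -/
def HasSimpleModuli (A : H →L[ℝ] H) : Prop :=
  ∀ (μ ν : ℝ) (v w : H), v ≠ 0 → A v = μ • v → A w = ν • w → |μ| = |ν| → ∃ a : ℝ, w = a • v

/-- Infinitely many such moduli would give orthonormal vectors whose images stay more than `ε`
apart, so no subsequence of the images could converge. -/
theorem finite_eigenvalueModuli_inter_Ici (hA : A.IsSymmetric) (hc : IsCompactOperator A)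
    {ε : ℝ} (hε : 0 < ε) : (eigenvalueModuli A ∩ Set.Ici ε).Finite := by
  by_contra hinf
  set g := Set.Infinite.natEmbedding _ hinf with hg
  choose μ v hv1 hv hμ using fun n => (g n).2.1
  have hε' (n : ℕ) : ε ≤ |μ n| := by
    rw [hμ]
    exact (g n).2.2
  have horth {i j : ℕ} (hij : i ≠ j) : ⟪v i, v j⟫ = 0 := by
    refine inner_eq_zero_of_eigenvalue_ne hA (hv i) (hv j) fun h => hij ?_
    refine g.injective (Subtype.ext ?_)
    rw [← hμ, ← hμ, h]
  have hK := IsCompactOperator.isCompact_closure_image_closedBall (𝕜₁ := ℝ)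
    (f := (A : H →ₗ[ℝ] H)) hc 1
  obtain ⟨x, -, φ, hφ, hlim⟩ := hK.tendsto_subseq (x := fun n => A (v n)) fun n =>
    subset_closure ⟨v n, by simp [hv1], rfl⟩
  obtain ⟨N, hN⟩ := Metric.cauchySeq_iff'.1 hlim.cauchySeq ε hε
  have h1 := hN (N + 1) (Nat.le_succ N)
  have hne : φ (N + 1) ≠ φ N := (hφ (Nat.lt_succ_self N)).ne'
  simp only [Function.comp_apply, hv, dist_eq_norm] at h1
  have h2 := norm_sub_sq_real (μ (φ (N + 1)) • v (φ (N + 1))) (μ (φ N) • v (φ N))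
  rw [real_inner_smul_left, real_inner_smul_right, horth hne, norm_smul, norm_smul, hv1, hv1,
    mul_one, mul_one, Real.norm_eq_abs, Real.norm_eq_abs] at h2
  have h3 := hε' (φ N)
  have h4 := hε' (φ (N + 1))
  nlinarith [norm_nonneg (μ (φ (N + 1)) • v (φ (N + 1)) - μ (φ N) • v (φ N))]

theorem orthogonal_span_eq_bot [CompleteSpace H] {ι : Type*} (hA : A.IsSymmetric) (hc : IsCompactOperator A)
    {e : ι → H} (he : ∀ (μ : ℝ) (v : H), A v = μ • v → v ∈ Submodule.span ℝ (Set.range e)) :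
    (Submodule.span ℝ (Set.range e))ᗮ = ⊥ := by
  rw [eq_bot_iff, ← ContinuousLinearMap.orthogonalComplement_iSup_eigenspaces_eq_bot hc hA]
  exact Submodule.orthogonal_le (iSup_le fun μ v hv => he μ v (Module.End.mem_eigenspace_iff.1 hv))

/-- With finitely many moduli, one eigenvector for each would span a finite-dimensional, hence
closed, space with trivial orthogonal complement: the whole of `H`. -/
theorem infinite_eigenvalueModuli [CompleteSpace H] (hA : A.IsSymmetric) (hc : IsCompactOperator A)
    (hdim : ¬ FiniteDimensional ℝ H)
    (hsimple : HasSimpleModuli A) :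
    (eigenvalueModuli A).Infinite := by
  intro hfin
  have := hfin.to_subtype
  choose μ v hv1 hv hμ using fun s : eigenvalueModuli A => s.2
  have hbot := orthogonal_span_eq_bot hA hc (e := v) fun ν w hw => by
    rcases eq_or_ne w 0 with rfl | hw0
    · exact Submodule.zero_mem _
    have hs : |ν| ∈ eigenvalueModuli A :=
      ⟨ν, ‖w‖⁻¹ • w, norm_smul_inv_norm hw0, by rw [map_smul, hw, smul_comm], rfl⟩
    obtain ⟨a, ha⟩ := hsimple _ _ (v ⟨|ν|, hs⟩) w
      (norm_ne_zero_iff.1 (by rw [hv1]; exact one_ne_zero)) (hv _) hw (hμ _)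
    rw [ha]
    exact Submodule.smul_mem _ _ (Submodule.subset_span (Set.mem_range_self _))
  have : FiniteDimensional ℝ (Submodule.span ℝ (Set.range v)) :=
    FiniteDimensional.span_of_finite ℝ (Set.finite_range v)
  rw [Submodule.orthogonal_eq_bot_iff] at hbot
  refine hdim ?_
  rw [hbot] at this
  exact Module.Finite.equiv (Submodule.topEquiv (R := ℝ) (M := H))

/-- A compact symmetric operator whose eigenvalues are simple and have distinct moduli has an
orthonormal sequence of eigenvectors, ordered by modulus, that exhausts the spectrum. -/
theorem exists_orthonormal_eigenvectors [CompleteSpace H] (hA : A.IsSymmetric) (hc : IsCompactOperator A)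
    (hdim : ¬ FiniteDimensional ℝ H) (hinj : ∀ v, A v = 0 → v = 0)
    (hsimple : HasSimpleModuli A) :
    ∃ (l : ℕ → ℝ) (e : ℕ → H), Orthonormal ℝ e ∧ (∀ n, A (e n) = l n • e n) ∧
      (StrictAnti fun n => |l n|) ∧ ∀ (μ : ℝ) (v : H), v ≠ 0 → A v = μ • v → ∃ n, ⟪e n, v⟫ ≠ 0 := by
  have hpos : ∀ s ∈ eigenvalueModuli A, 0 < s := by
    rintro s ⟨μ, v, hv1, hv, rfl⟩
    refine abs_pos.2 fun h => ?_
    rw [h, zero_smul] at hv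
    rw [hinj v hv, norm_zero] at hv1
    exact zero_ne_one hv1
  obtain ⟨f, hf, hrange⟩ := exists_strictAnti_range_eq
    (fun s hs => (finite_eigenvalueModuli_inter_Ici hA hc (hpos s hs)).subset
      (Set.inter_subset_inter_right _ Set.Ioi_subset_Ici_self))
    (infinite_eigenvalueModuli hA hc hdim hsimple)
  have hmem (n : ℕ) : f n ∈ eigenvalueModuli A := hrange ▸ Set.mem_range_self n
  choose l e he1 he hl using hmem
  have hle : (fun n => |l n|) = f := funext hl
  refine ⟨l, e, ⟨he1, fun i j hij => ?_⟩, he, hle ▸ hf, fun μ v hv0 hv => ?_⟩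
  · refine inner_eq_zero_of_eigenvalue_ne hA (he i) (he j) fun h => hij (hf.injective ?_)
    rw [← hl, ← hl, h]
  · have hs : |μ| ∈ eigenvalueModuli A :=
      ⟨μ, ‖v‖⁻¹ • v, norm_smul_inv_norm hv0, by rw [map_smul, hv, smul_comm], rfl⟩
    rw [← hrange] at hs
    obtain ⟨n, hn⟩ := hs
    obtain ⟨a, ha⟩ := hsimple _ _ v (e n) hv0 hv (he n) (by rw [hl, hn])
    refine ⟨n, fun h0 => ?_⟩
    have h1 := he1 n
    rw [ha, real_inner_smul_left, mul_eq_zero, inner_self_eq_zero] at h0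
    rcases h0 with h0 | h0
    · rw [ha, h0, zero_smul, norm_zero] at h1
      exact zero_ne_one h1
    · exact hv0 h0

theorem orthogonal_span_eq_bot_of_exhaustive [CompleteSpace H] (hA : A.IsSymmetric) (hc : IsCompactOperator A)
    (hsimple : HasSimpleModuli A)
    {l : ℕ → ℝ} {e : ℕ → H} (ho : Orthonormal ℝ e) (he : ∀ n, A (e n) = l n • e n)
    (hex : ∀ (μ : ℝ) (v : H), v ≠ 0 → A v = μ • v → ∃ n, ⟪e n, v⟫ ≠ 0) :
    (Submodule.span ℝ (Set.range e))ᗮ = ⊥ := by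
  refine orthogonal_span_eq_bot hA hc fun μ v hv => ?_
  rcases eq_or_ne v 0 with rfl | hv0
  · exact Submodule.zero_mem _
  obtain ⟨n, hn⟩ := hex μ v hv0 hv
  have hμ : l n = μ := by
    by_contra h
    exact hn (inner_eq_zero_of_eigenvalue_ne hA (he n) hv h)
  obtain ⟨a, rfl⟩ := hsimple _ _ (e n) v (ho.ne_zero n) (he n) hv (by rw [hμ])
  exact Submodule.smul_mem _ _ (Submodule.subset_span (Set.mem_range_self _))

theorem strictAnti_abs_eigenvalue
    (hsimple : HasSimpleModuli A)
    {l : ℕ → ℝ} {e : ℕ → H} (ho : Orthonormal ℝ e) (he : ∀ n, A (e n) = l n • e n)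
    (hl : ∀ n, |l (n + 1)| ≤ |l n|) : StrictAnti fun n => |l n| := by
  refine strictAnti_nat_of_succ_lt fun n => lt_of_le_of_ne (hl n) fun h => ?_
  obtain ⟨a, ha⟩ := hsimple _ _ (e n) (e (n + 1)) (ho.ne_zero n) (he n) (he (n + 1)) h.symm
  have h0 : ⟪e n, e (n + 1)⟫ = 0 := ho.2 (Nat.lt_succ_self n).ne
  have h1 := ho.1 n
  rw [ha, real_inner_smul_right, real_inner_self_eq_norm_sq, h1, one_pow, mul_one] at h0
  exact ho.ne_zero (n + 1) (by rw [ha, h0, zero_smul])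

end Spectral

/-! ### Simple spectrum of the Airy operator. -/

theorem halfLine_inter_Ico (n m : ℕ) :
    halfLine.real (Set.Ico (n : ℝ) (n + 1) ∩ Set.Ico (m : ℝ) (m + 1)) = if n = m then 1 else 0 := by
  split_ifs with h
  · subst h
    have : Set.Ico (n : ℝ) (n + 1) ∩ Set.Ici 0 = Set.Ico (n : ℝ) (n + 1) :=
      Set.inter_eq_left.2 fun x hx => (Nat.cast_nonneg n).trans hx.1
    rw [Set.inter_self, measureReal_def, halfLine, Measure.restrict_apply measurableSet_Ico, this,
      Real.volume_Ico]
    simp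
  · have : Set.Ico (n : ℝ) (n + 1) ∩ Set.Ico (m : ℝ) (m + 1) = ∅ := by
      refine Set.eq_empty_of_forall_notMem fun x hx => h ?_
      have h1 : (n : ℝ) < m + 1 := hx.1.1.trans_lt hx.2.2
      have h2 : (m : ℝ) < n + 1 := hx.2.1.trans_lt hx.1.2
      norm_cast at h1 h2
      omega
    rw [this, measureReal_empty]

theorem not_finiteDimensional_halfLineL2 : ¬ FiniteDimensional ℝ HalfLineL2 := by
  intro hfin
  have hfinite (n : ℕ) : halfLine (Set.Ico (n : ℝ) (n + 1)) ≠ ⊤ :=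
    ((Measure.restrict_apply_le _ _).trans_lt (by simp)).ne
  have ho : Orthonormal ℝ fun n : ℕ => (indicatorConstLp 2 measurableSet_Ico (hfinite n) (1 : ℝ) :
      HalfLineL2) := by
    rw [orthonormal_iff_ite]
    intro i j
    rw [L2.real_inner_indicatorConstLp_one_indicatorConstLp_one _ _ (hfinite i) (hfinite j),
      halfLine_inter_Ico]
  have := ho.linearIndependent.finite
  exact not_finite ℕ

theorem eigenvalue_ne_zero_of_airyL {c μ : ℝ} {v : HalfLineL2} (hv0 : v ≠ 0)
    (hv : airyL c v = μ • v) : μ ≠ 0 := by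
  rintro rfl
  rw [zero_smul] at hv
  refine hv0 ((Lp.eq_zero_iff_ae_eq_zero).2 (ae_eq_zero_of_airyOp_eq_zero (Lp.memLp v) (c := c) ?_))
  have h1 : airyOp c v =ᵐ[halfLine] fun _ => 0 := by
    filter_upwards [coeFn_airyL c v, (Lp.eq_zero_iff_ae_eq_zero).1 hv] with x h2 h3
    rw [← h2, h3, Pi.zero_apply]
  -- The operator equation holds only almost everywhere; continuity upgrades it to every `x > 0`.
  have hcont : Continuous (airyOp c v) := by
    have h2 (x : ℝ) : HasDerivAt (fun s => ∫ y, airyAi (s + y) * v y ∂halfLine) _ x :=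
      hasDerivAt_integral_airyAi (Lp.memLp v).integrable_mul_exp_neg
      (by simpa using (Lp.memLp v).integrable_mul_pow_mul_exp_neg 1) x
    have hc : Continuous fun s => ∫ y, airyAi (s + y) * v y ∂halfLine :=
      continuous_iff_continuousAt.2 fun x => (h2 x).continuousAt
    simp only [funext (airyOp_eq c _)]
    exact hc.comp (continuous_id.add continuous_const)
  exact fun x hx => Measure.eqOn_open_of_ae_eq (U := Set.Ioi (0 : ℝ))
    (ae_restrict_of_ae_restrict_of_subset Set.Ioi_subset_Ici_self h1) isOpen_Ioi
    hcont.continuousOn continuousOn_const hx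

/-- The representative is `μ⁻¹ T_c v`, defined on the whole line; this gives meaning to the value at
`0`. -/
theorem exists_isAiryEigenfun {c μ : ℝ} {v : HalfLineL2} (hv0 : v ≠ 0)
    (hv : airyL c v = μ • v) :
    μ ≠ 0 ∧ ∃ F, IsAiryEigenfun c μ F ∧ F 0 ≠ 0 ∧ F =ᵐ[halfLine] v := by
  have hμ := eigenvalue_ne_zero_of_airyL hv0 hv
  have hae : (fun x => μ⁻¹ * airyOp c v x) =ᵐ[halfLine] v := by
    filter_upwards [coeFn_airyL c v, Lp.coeFn_smul μ v] with x h1 h2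
    rw [← h1, hv, h2, Pi.smul_apply, smul_eq_mul, inv_mul_cancel_left₀ hμ]
  have hF : IsAiryEigenfun c μ fun x => μ⁻¹ * airyOp c v x :=
    ⟨(Lp.memLp v).ae_eq hae.symm, fun x => by
      rw [airyOp_congr hae, mul_inv_cancel_left₀ hμ]⟩
  refine ⟨hμ, _, hF, fun h0 => hv0 ?_, hae⟩
  rw [hF.eq_zero hμ h0] at hae
  exact (Lp.eq_zero_iff_ae_eq_zero).2 hae.symm

theorem hasSimpleModuli_airyL (c : ℝ) : HasSimpleModuli (airyL c) := by
  intro μ ν v w hv0 hv hw hμν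
  rcases eq_or_ne w 0 with rfl | hw0
  · exact ⟨0, by simp⟩
  obtain ⟨hμ, F, hF, hF0, hFv⟩ := exists_isAiryEigenfun hv0 hv
  obtain ⟨hν, G, hG, hG0, hGw⟩ := exists_isAiryEigenfun hw0 hw
  rcases abs_eq_abs.1 hμν with rfl | h
  · refine ⟨G 0 / F 0, Lp.ext ?_⟩
    filter_upwards [hFv, hGw, Lp.coeFn_smul (G 0 / F 0) v] with x h1 h2 h3
    rw [h3, Pi.smul_apply, smul_eq_mul, ← h1, ← h2]
    have := hF.proportional hG hμ x
    field_simp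
    linarith
  · obtain rfl : ν = -μ := by linarith
    rcases hF.eq_zero_or_eq_zero_of_neg hG hμ with rfl | rfl
    · exact absurd rfl hF0
    · exact absurd rfl hG0

theorem IsAiryEigenfun.isAiryEigenpair {c μ : ℝ} {F : ℝ → ℝ} (h : IsAiryEigenfun c μ F)
    (hμ : μ ≠ 0) (h0 : F 0 ≠ 0) : IsAiryEigenpair c μ F :=
  ⟨h.memLp, fun hae => h0 (by rw [h.eq_zero_of_ae_eq_zero hμ hae, Pi.zero_apply]),
    fun x _ => h.eigen x⟩

theorem integral_mul_toLp {f g : ℝ → ℝ} (hf : MemLp f 2 halfLine) (hg : MemLp g 2 halfLine) :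
    ⟪hf.toLp f, hg.toLp g⟫ = ∫ x, f x * g x ∂halfLine := by
  rw [inner_eq_integral]
  refine integral_congr_ae ?_
  filter_upwards [hf.coeFn_toLp, hg.coeFn_toLp] with x h1 h2
  rw [h1, h2]

namespace IsAiryEigenpair

variable {c μ : ℝ} {f : ℝ → ℝ}

theorem toLp_ne_zero (h : IsAiryEigenpair c μ f) : h.memLp.toLp f ≠ 0 := fun h0 =>
  h.ne_zero (h.memLp.coeFn_toLp.symm.trans ((Lp.eq_zero_iff_ae_eq_zero).1 h0))

theorem airyL_toLp (h : IsAiryEigenpair c μ f) :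
    airyL c (h.memLp.toLp f) = μ • h.memLp.toLp f := by
  refine Lp.ext ?_
  filter_upwards [coeFn_airyL c (h.memLp.toLp f), Lp.coeFn_smul μ (h.memLp.toLp f),
    h.memLp.coeFn_toLp, ae_halfLine_of_forall fun x hx => h.eigen x hx] with x h1 h2 h3 h4
  rw [h1, h2, Pi.smul_apply, h3, smul_eq_mul, h4]
  exact airyOp_congr h.memLp.coeFn_toLp x

theorem exists_extension (h : IsAiryEigenpair c μ f) :
    μ ≠ 0 ∧ ∃ F, IsAiryEigenfun c μ F ∧ F 0 = f 0 ∧ F =ᵐ[halfLine] f := by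
  obtain ⟨hμ, F, hF, -, hae⟩ := exists_isAiryEigenfun h.toLp_ne_zero h.airyL_toLp
  have hFf := hae.trans h.memLp.coeFn_toLp
  refine ⟨hμ, F, hF, mul_left_cancel₀ hμ ?_, hFf⟩
  rw [hF.eigen, h.eigen 0 le_rfl]
  exact airyOp_congr hFf 0

end IsAiryEigenpair

/-! ### Derivative of the quadratic form, eigensystems, and conclusion. -/

theorem hasDerivAt_inner_airyL {c μ : ℝ} {f : ℝ → ℝ} (h : IsAiryEigenpair c μ f) :
    HasDerivAt (fun t => ⟪airyL t (h.memLp.toLp f), h.memLp.toLp f⟫)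
      (-(1 / 2) * μ * f 0 ^ 2) c := by
  obtain ⟨hμ, F, hF, hF0, hFf⟩ := h.exists_extension
  have hFv := hFf.trans h.memLp.coeFn_toLp.symm
  obtain ⟨C, hC⟩ := hF.exists_bound hμ
  -- Changing `c` to `t` translates the argument of the extended eigenfunction. For `t < c` this
  -- uses its values at negative points.
  have hfun (t : ℝ) : ⟪airyL t (h.memLp.toLp f), h.memLp.toLp f⟫ =
      μ * ∫ y, F (t + -c + y) * F y ∂halfLine := by
    rw [inner_eq_integral, ← integral_const_mul]
    refine integral_congr_ae ?_
    filter_upwards [coeFn_airyL t (h.memLp.toLp f), hFv] with x h1 h2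
    rw [h1, ← h2, ← mul_assoc, hF.eigen, ← airyOp_congr hFv x, airyOp_eq, airyOp_eq]
    congr 3 with y
    ring_nf
  have hi := hF.memLp.integrable_mul_exp_neg
  have hd : HasDerivAt (fun s => ∫ y, F (s + y) * F y ∂halfLine)
      (∫ y, deriv F (0 + y) * F y ∂halfLine) 0 := by
    refine hasDerivAt_integral_shift_mul (hF.hasDerivAt hμ) (hF.expDecay_deriv hμ).cont
      (fun x => (hC x).1) (D := C * Real.exp 1) (fun x hx y hy => ?_) hi ?_
    · rw [Metric.mem_ball, Real.dist_eq, sub_zero] at hx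
      have hC0 : 0 ≤ C := by simpa using (abs_nonneg _).trans (hC 0).1
      refine ((hC _).2).trans ?_
      rw [mul_assoc]
      refine mul_le_mul_of_nonneg_left ?_ hC0
      have h1 : Real.exp (-(x + y)) ≤ Real.exp 1 * Real.exp (-y) := by
        rw [← Real.exp_add]
        exact Real.exp_le_exp.2 (by linarith [(abs_lt.1 hx).1])
      have h2 : Real.exp (-y) ≤ (1 + y) * Real.exp (-y) :=
        le_mul_of_one_le_left (Real.exp_pos _).le (by linarith)
      exact h1.trans (mul_le_mul_of_nonneg_left h2 (Real.exp_pos _).le)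
    · refine (hi.add (hF.memLp.integrable_mul_pow_mul_exp_neg 1)).congr
        (Eventually.of_forall fun y => ?_)
      simp only [Pi.add_apply, pow_one]
      ring
  rw [← add_neg_cancel c] at hd
  have hd' := (hd.comp_add_const c (-c)).const_mul μ
  simp only [hfun]
  refine hd'.congr_deriv ?_
  simp only [add_neg_cancel, zero_add]
  rw [hF.integral_deriv_mul_self hμ, hF0]
  ring

theorem exists_isAiryEigensystem (c : ℝ) : ∃ (lam : ℕ → ℝ) (psi : ℕ → ℝ → ℝ),
    IsAiryEigensystem c lam psi ∧ ∀ n, 0 < psi n 0 := by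
  obtain ⟨l, e, ho, he, hl, hex⟩ := exists_orthonormal_eigenvectors (airyL_isSymmetric c)
    (isCompactOperator_airyL c) not_finiteDimensional_halfLineL2
    (fun v hv => by
      by_contra hv0
      exact eigenvalue_ne_zero_of_airyL hv0 (hv.trans (zero_smul ℝ v).symm) rfl)
    (hasSimpleModuli_airyL c)
  -- Since `F 0 ≠ 0` for every eigenfunction, a sign `s` makes the value at `0` positive; `s * s =
  -- 1` preserves orthonormality.
  have hsign (n : ℕ) : ∃ (F : ℝ → ℝ) (s : ℝ), IsAiryEigenpair c (l n) F ∧ 0 < F 0 ∧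
      (s = 1 ∨ s = -1) ∧ F =ᵐ[halfLine] fun x => s * e n x := by
    obtain ⟨hμ, F, hF, hF0, hae⟩ := exists_isAiryEigenfun (ho.ne_zero n) (he n)
    rcases lt_or_gt_of_ne hF0 with h | h
    · refine ⟨fun x => -1 * F x, -1, (hF.const_mul (-1)).isAiryEigenpair hμ (by simpa using hF0),
        by simpa using h, Or.inr rfl, ?_⟩
      filter_upwards [hae] with x hx
      rw [hx]
    · refine ⟨F, 1, hF.isAiryEigenpair hμ hF0, h, Or.inl rfl, ?_⟩
      filter_upwards [hae] with x hx
      rw [hx, one_mul]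
  choose psi s hpair hpos hs hae using hsign
  have hs1 (n : ℕ) : s n * s n = 1 := by rcases hs n with h | h <;> simp [h]
  refine ⟨l, psi, ⟨hpair, fun m n => ?_, fun μ f hf => ?_, fun n => hl.antitone n.le_succ⟩, hpos⟩
  · have h1 : ∫ x, psi m x * psi n x ∂halfLine = s m * s n * ⟪e m, e n⟫ := by
      rw [inner_eq_integral, ← integral_const_mul]
      refine integral_congr_ae ?_
      filter_upwards [hae m, hae n] with x h1 h2
      rw [h1, h2]
      ring
    rw [h1, orthonormal_iff_ite.1 ho]
    split_ifs with h
    · rw [h, hs1, one_mul]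
    · rw [mul_zero]
  · obtain ⟨n, hn⟩ := hex μ (hf.memLp.toLp f) hf.toLp_ne_zero hf.airyL_toLp
    refine ⟨n, fun h0 => hn ?_⟩
    have h1 : ∫ x, psi n x * f x ∂halfLine = s n * ⟪e n, hf.memLp.toLp f⟫ := by
      rw [inner_eq_integral, ← integral_const_mul]
      refine integral_congr_ae ?_
      filter_upwards [hae n, hf.memLp.coeFn_toLp] with x h1 h2
      rw [h1, h2]
      ring
    rw [h1] at h0
    exact (mul_eq_zero.1 h0).resolve_left fun h => by simpa [h] using hs1 n

theorem exists_isAiryEigenpair_toLp_eq {c μ : ℝ} {v : HalfLineL2} (hv0 : v ≠ 0)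
    (hv : airyL c v = μ • v) :
    ∃ F, ∃ h : IsAiryEigenpair c μ F, h.memLp.toLp F = v := by
  obtain ⟨hμ, F, hF, hF0, hae⟩ := exists_isAiryEigenfun hv0 hv
  refine ⟨F, hF.isAiryEigenpair hμ hF0, Lp.ext ?_⟩
  exact (MemLp.coeFn_toLp _).trans hae

theorem IsAiryEigensystem.exists_hilbertBasis {c : ℝ} {lam : ℕ → ℝ} {psi : ℕ → ℝ → ℝ}
    (h : IsAiryEigensystem c lam psi) :
    ∃ b : HilbertBasis ℕ ℝ HalfLineL2, (∀ n, b n = (h.eigenpair n).memLp.toLp (psi n)) ∧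
      (∀ n, airyL c (b n) = lam n • b n) ∧ StrictAnti fun n => |lam n| := by
  set e : ℕ → HalfLineL2 := fun n => (h.eigenpair n).memLp.toLp (psi n) with he
  have ho : Orthonormal ℝ e := by
    rw [orthonormal_iff_ite]
    intro i j
    rw [he, integral_mul_toLp, h.orthonormal]
  have heig (n : ℕ) : airyL c (e n) = lam n • e n := (h.eigenpair n).airyL_toLp
  have hbot := orthogonal_span_eq_bot_of_exhaustive (airyL_isSymmetric c)
    (isCompactOperator_airyL c) (hasSimpleModuli_airyL c) ho heig fun μ v hv0 hv => by
      obtain ⟨F, hF, rfl⟩ := exists_isAiryEigenpair_toLp_eq hv0 hv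
      obtain ⟨n, hn⟩ := h.exhaustive μ F hF
      exact ⟨n, by rwa [he, integral_mul_toLp]⟩
  have hb : ⇑(HilbertBasis.mkOfOrthogonalEqBot ho hbot) = e :=
    HilbertBasis.coe_mkOfOrthogonalEqBot ho hbot
  refine ⟨HilbertBasis.mkOfOrthogonalEqBot ho hbot, fun n => by rw [hb], fun n => ?_,
    strictAnti_abs_eigenvalue (hasSimpleModuli_airyL c) ho heig h.ordered⟩
  rw [hb, heig]

theorem mainTheorem3 :
    (∀ c : ℝ, ∃ (lam : ℕ → ℝ) (psi : ℕ → ℝ → ℝ),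
      IsAiryEigensystem c lam psi ∧ ∀ n, 0 < psi n 0) ∧
    ∀ (lam : ℕ → ℝ → ℝ) (psi : ℕ → ℝ → ℝ → ℝ),
      (∀ c : ℝ, IsAiryEigensystem c (fun n => lam n c) (fun n => psi n c)) →
      ∀ (n : ℕ) (c : ℝ),
        HasDerivAt (fun c' : ℝ => lam n c') (-(1 / 2) * lam n c * (psi n c 0) ^ 2) c ∧
        HasDerivAt (fun c' : ℝ => (lam n c') ^ 2) (-(lam n c) ^ 2 * (psi n c 0) ^ 2) c := by
  refine ⟨exists_isAiryEigensystem, fun lam psi h n c => ?_⟩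
  choose b hb hbeig hanti using fun t => (h t).exists_hilbertBasis
  obtain ⟨K, -, hK⟩ := exists_norm_airyL_sub_le c
  have hder : HasDerivAt (fun c' : ℝ => lam n c') (-(1 / 2) * lam n c * (psi n c 0) ^ 2) c := by
    refine hasDerivAt_eigenvalue (A := airyL) (b := b) (l := fun t n => lam n t)
      airyL_isSymmetric hbeig hanti hK n ?_
    rw [hb]
    exact hasDerivAt_inner_airyL ((h c).eigenpair n)
  refine ⟨hder, (hder.pow 2).congr_deriv ?_⟩
  push_cast
  ring
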